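/- Let $A$ be a real symmetric positive definite $n\times n$ matrix and let $w_1,\dots,w_n>0$ be such that $w_1^2,\dots,w_n^2$ are the eigenvalues of $A$, counted with multiplicity. For $\lambda>0$ and $h>0$ consider on $L^2(\mathbb R^n)$ the operators $$K(\lambda)=-\Delta+\lambda^2\langle Ax,x\rangle,\qquad K=K(1)=-\Delta+\langle Ax,x\rangle,\qquad P(h)=-h^2\Delta+\langle Ax,x\rangle,$$ each with domain $\{u\in H^2(\mathbb R^n): \langle Ax,x\rangle u\in L^2(\mathbb R^n)\}$, and for $\theta>0$ the unitary dilation $(U_\theta\psi)(x)=\theta^{n/2}\psi(\theta x)$. Then: 1. $U_{\lambda^{-1/2}}\,K(\lambda)\,U_{\lambda^{-1/2}}^{-1}=\lambda K$ as unbounded operators (including equality of domains). 2. $\sigma(K(\lambda))=\lambda\,\sigma(K)=\bigl\{\sum_{i=1}^n(2n_i+1)\lambda w_i:\ n_1,\dots,n_n\in\mathbb Z_{\ge 0}\bigr\}$, and the spectrum of $K(\lambda)$ is purely discrete, that is, it consists of isolated eigenvalues of finite algebraic multiplicity. 3. For every $\mu\in\mathbb C$, $\dim\ker(K(\lambda)-\lambda\mu)=\dim\ker(K-\mu)$,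 so corresponding eigenvalues have the same multiplicity. Moreover, $\Psi\in\ker(K-\mu)$ if and only if $U_{\lambda^{1/2}}\Psi\in\ker(K(\lambda)-\lambda\mu)$, where $U_{\lambda^{1/2}}=U_{\lambda^{-1/2}}^{-1}$; so if $\Psi_p$ are the eigenfunctions of $K$, then $U_{\lambda^{1/2}}\Psi_p$ are the eigenfunctions of $K(\lambda)$. 4. For every $h>0$, $\sigma(P(h))=h\,\sigma(K)$, and the spectrum of $P(h)$ is purely discrete. -/

import Mathlib

noncomputable section

namespace LinearPMap

variable {H : Type*} [NormedAddCommGroup H] [InnerProductSpace ℂ H]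

/-! ### Spectral notions for an unbounded operator `T` with domain `T.domain ⊆ H` -/

/-- The resolvent set: `T - z` is invertible, that is, it maps `T.domain` bijectively onto `H`
and its inverse `R` is a bounded operator on `H`. -/
def opResolventSet (T : H →ₗ.[ℂ] H) : Set ℂ :=
  {z | ∃ R : H →L[ℂ] H,
    (∀ f : H, ∃ hf : R f ∈ T.domain, T ⟨R f, hf⟩ - z • R f = f) ∧
    ∀ u : T.domain, R (T u - z • (u : H)) = u}

/-- The spectrum `σ(T)`. -/
def opSpectrum (T : H →ₗ.[ℂ] H) : Set ℂ := (opResolventSet T)ᶜ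

/-- The preimage of a subspace `W` under `T - z`, as a subspace of `H` contained in the domain. -/
def preimageSub (T : H →ₗ.[ℂ] H) (z : ℂ) (W : Submodule ℂ H) : Submodule ℂ H where
  carrier := {u | ∃ hu : u ∈ T.domain, T ⟨u, hu⟩ - z • u ∈ W}
  zero_mem' := ⟨T.domain.zero_mem, by
    have h : T ⟨0, T.domain.zero_mem⟩ = 0 := T.map_zero
    rw [h]; simp⟩
  add_mem' := by
    rintro u v ⟨hu, hu'⟩ ⟨hv, hv'⟩
    refine ⟨T.domain.add_mem hu hv, ?_⟩
    have h : T ⟨u + v, T.domain.add_mem hu hv⟩ = T ⟨u, hu⟩ + T ⟨v, hv⟩ :=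
      T.map_add ⟨u, hu⟩ ⟨v, hv⟩
    rw [h, smul_add, add_sub_add_comm]
    exact W.add_mem hu' hv'
  smul_mem' := by
    rintro c u ⟨hu, hu'⟩
    refine ⟨T.domain.smul_mem c hu, ?_⟩
    have h : T ⟨c • u, T.domain.smul_mem c hu⟩ = c • T ⟨u, hu⟩ := T.map_smul c ⟨u, hu⟩
    rw [h, smul_comm z c u, ← smul_sub]
    exact W.smul_mem c hu'

/-- The eigenspace `ker (T - z)`. Its dimension is the (geometric) multiplicity of `z`. -/
def eigenspace (T : H →ₗ.[ℂ] H) (z : ℂ) : Submodule ℂ H := preimageSub T z ⊥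

/-- The generalized eigenspace `⋃ₖ ker (T - z)ᵏ`. Its dimension is the algebraic multiplicity. -/
def genEigenspace (T : H →ₗ.[ℂ] H) (z : ℂ) : Submodule ℂ H :=
  ⨆ k : ℕ, (preimageSub T z)^[k] ⊥

/-- The discrete spectrum: the eigenvalues of finite algebraic multiplicity that are isolated
points of the spectrum. -/
def discreteSpectrum (T : H →ₗ.[ℂ] H) : Set ℂ :=
  {z | z ∈ opSpectrum T ∧ eigenspace T z ≠ ⊥ ∧ FiniteDimensional ℂ (genEigenspace T z) ∧
    ∃ ε > 0, ∀ z' ∈ opSpectrum T, z' ≠ z → ε ≤ dist z' z}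

/-- The essential spectrum: the complement of the discrete spectrum in the spectrum. -/
def essentialSpectrum (T : H →ₗ.[ℂ] H) : Set ℂ := opSpectrum T \ discreteSpectrum T

/-- The spectrum is purely discrete: there is no essential spectrum. -/
def HasPurelyDiscreteSpectrum (T : H →ₗ.[ℂ] H) : Prop := essentialSpectrum T = ∅

/-- The conjugated operator `U T U⁻¹`, with domain `U (T.domain)`, for a unitary `U`. -/
def unitaryConj (U : H ≃ₗᵢ[ℂ] H) (T : H →ₗ.[ℂ] H) : H →ₗ.[ℂ] H where
  domain := T.domain.comap (U.symm.toLinearEquiv : H →ₗ[ℂ] H)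
  toFun := (U.toLinearEquiv : H →ₗ[ℂ] H) ∘ₗ T.toFun ∘ₗ
    ((U.symm.toLinearEquiv : H →ₗ[ℂ] H).restrict (p := T.domain.comap
      (U.symm.toLinearEquiv : H →ₗ[ℂ] H)) (q := T.domain) fun _ hx => hx)

theorem mem_unitaryConj_domain (U : H ≃ₗᵢ[ℂ] H) (T : H →ₗ.[ℂ] H) (v : H) :
    v ∈ (unitaryConj U T).domain ↔ U.symm v ∈ T.domain := Iff.rfl

theorem unitaryConj_apply (U : H ≃ₗᵢ[ℂ] H) (T : H →ₗ.[ℂ] H) (v : (unitaryConj U T).domain) :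
    unitaryConj U T v = U (T ⟨U.symm v, v.2⟩) := rfl

end LinearPMap

namespace HarmonicOscillator

section

open MeasureTheory TemperedDistribution
open scoped SchwartzMap Laplacian ENNReal

/-- The Hilbert space `L²(ℝⁿ; ℂ)`. -/
abbrev L2 (n : ℕ) : Type := Lp ℂ 2 (volume : Measure (EuclideanSpace ℝ (Fin n)))

/-! ### Dilations -/

theorem eLpNorm_comp_smul {n : ℕ} {θ : ℝ} (hθ : 0 < θ) (f : L2 n) :
    MemLp (fun x => ((θ ^ ((n : ℝ) / 2) : ℝ) : ℂ) * f (θ • x)) 2 volume ∧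
    eLpNorm (fun x => ((θ ^ ((n : ℝ) / 2) : ℝ) : ℂ) * f (θ • x)) 2 volume =
      eLpNorm f 2 volume := by
  have hmap := Measure.map_addHaar_smul (volume : Measure (EuclideanSpace ℝ (Fin n))) hθ.ne'
  have hemb : MeasurableEmbedding (fun x : EuclideanSpace ℝ (Fin n) => θ • x) :=
    (Homeomorph.smulOfNeZero θ hθ.ne').measurableEmbedding
  have hc0 : ENNReal.ofReal |(θ ^ Module.finrank ℝ (EuclideanSpace ℝ (Fin n)))⁻¹| ≠ 0 := by
    rw [Ne, ENNReal.ofReal_eq_zero, not_le]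
    positivity
  have hac : AEStronglyMeasurable (fun x => f (θ • x)) volume := by
    have h1 : AEStronglyMeasurable f
        (Measure.map (fun x : EuclideanSpace ℝ (Fin n) => θ • x) volume) := by
      rw [hmap]
      exact (Lp.aestronglyMeasurable f).smul_measure _
    exact h1.comp_measurable hemb.measurable
  have hnorm : eLpNorm (fun x => ((θ ^ ((n : ℝ) / 2) : ℝ) : ℂ) * f (θ • x)) 2 volume =
      eLpNorm f 2 volume := by
    have h1 : eLpNorm (fun x => f (θ • x)) 2 volume =
        ENNReal.ofReal |(θ ^ Module.finrank ℝ (EuclideanSpace ℝ (Fin n)))⁻¹| ^ (1 / 2 : ℝ) *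
          eLpNorm f 2 volume := by
      have h2 := hemb.eLpNorm_map_measure (g := f) (p := 2) (μ := volume)
      rw [hmap, eLpNorm_smul_measure_of_ne_top (by simp)] at h2
      simpa [Function.comp_def] using h2.symm
    have h3 : (fun x => ((θ ^ ((n : ℝ) / 2) : ℝ) : ℂ) * f (θ • x)) =
        ((θ ^ ((n : ℝ) / 2) : ℝ) : ℂ) • fun x => f (θ • x) := rfl
    rw [h3, eLpNorm_const_smul, h1, ← mul_assoc]
    have h4 : ‖((θ ^ ((n : ℝ) / 2) : ℝ) : ℂ)‖ₑ = ENNReal.ofReal (θ ^ ((n : ℝ) / 2)) := by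
      rw [← ofReal_norm, Complex.norm_real, Real.norm_of_nonneg (by positivity)]
    have h5 : θ ^ ((n : ℝ) / 2) * |(θ ^ n)⁻¹| ^ (1 / 2 : ℝ) = 1 := by
      rw [abs_of_pos (by positivity), Real.inv_rpow (by positivity), ← Real.rpow_natCast,
        ← Real.rpow_mul hθ.le, mul_one_div]
      exact mul_inv_cancel₀ (by positivity)
    rw [h4, finrank_euclideanSpace_fin, ENNReal.ofReal_rpow_of_pos (by positivity),
      ← ENNReal.ofReal_mul (by positivity), h5, ENNReal.ofReal_one, one_mul]
  exact ⟨⟨hac.const_mul _, hnorm ▸ Lp.eLpNorm_lt_top f⟩, hnorm⟩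

theorem ae_comp_smul {n : ℕ} {θ : ℝ} (hθ : 0 < θ) {p : EuclideanSpace ℝ (Fin n) → Prop}
    (hp : ∀ᵐ x, p x) : ∀ᵐ x : EuclideanSpace ℝ (Fin n), p (θ • x) := by
  have hmap := Measure.map_addHaar_smul (volume : Measure (EuclideanSpace ℝ (Fin n))) hθ.ne'
  have hemb : MeasurableEmbedding (fun x : EuclideanSpace ℝ (Fin n) => θ • x) :=
    (Homeomorph.smulOfNeZero θ hθ.ne').measurableEmbedding
  have h1 : ∀ᵐ x ∂(Measure.map (fun x : EuclideanSpace ℝ (Fin n) => θ • x) volume), p x := by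
    rw [hmap]
    exact Measure.ae_smul_measure hp _
  exact hemb.ae_map_iff.1 h1

/-- The dilation as a function on `L²`: `(U_θ f)(x) = θ ^ (n / 2) f (θ x)`. -/
def dilationFun {n : ℕ} {θ : ℝ} (hθ : 0 < θ) (f : L2 n) : L2 n :=
  (eLpNorm_comp_smul hθ f).1.toLp _

theorem dilationFun_ae {n : ℕ} {θ : ℝ} (hθ : 0 < θ) (f : L2 n) :
    dilationFun hθ f =ᵐ[volume] fun x => ((θ ^ ((n : ℝ) / 2) : ℝ) : ℂ) * f (θ • x) :=
  MemLp.coeFn_toLp _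

theorem dilationFun_dilationFun {n : ℕ} {θ θ' : ℝ} (hθ : 0 < θ) (hθ' : 0 < θ')
    (h : θ * θ' = 1) (f : L2 n) : dilationFun hθ (dilationFun hθ' f) = f := by
  apply Lp.ext
  filter_upwards [dilationFun_ae hθ (dilationFun hθ' f),
    ae_comp_smul hθ (dilationFun_ae hθ' f)] with x h1 h2
  rw [h1, h2, smul_smul, mul_comm θ' θ, h, one_smul, ← mul_assoc, ← Complex.ofReal_mul,
    ← Real.mul_rpow hθ.le hθ'.le, h, Real.one_rpow, Complex.ofReal_one, one_mul]

/-- The dilation `U_θ`, `(U_θ f)(x) = θ ^ (n / 2) f (θ x)`, as a unitary operator on `L²(ℝⁿ)`. -/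
def dilation {n : ℕ} (θ : ℝ) (hθ : 0 < θ) : L2 n ≃ₗᵢ[ℂ] L2 n where
  toFun := dilationFun hθ
  invFun := dilationFun (inv_pos.2 hθ)
  left_inv := dilationFun_dilationFun _ _ (inv_mul_cancel₀ hθ.ne')
  right_inv := dilationFun_dilationFun _ _ (mul_inv_cancel₀ hθ.ne')
  map_add' f g := by
    apply Lp.ext
    filter_upwards [dilationFun_ae hθ (f + g), dilationFun_ae hθ f, dilationFun_ae hθ g,
      ae_comp_smul hθ (Lp.coeFn_add f g), Lp.coeFn_add (dilationFun hθ f) (dilationFun hθ g)]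
      with x h1 h2 h3 h4 h5
    rw [h1, h5, Pi.add_apply, h2, h3, h4, Pi.add_apply, mul_add]
  map_smul' c f := by
    apply Lp.ext
    filter_upwards [dilationFun_ae hθ (c • f), dilationFun_ae hθ f,
      ae_comp_smul hθ (Lp.coeFn_smul c f), Lp.coeFn_smul c (dilationFun hθ f)] with x h1 h2 h3 h4
    rw [h1, RingHom.id_apply, h4, Pi.smul_apply, h2, h3, Pi.smul_apply, smul_eq_mul, smul_eq_mul,
      mul_left_comm]
  norm_map' f := by
    change ‖dilationFun hθ f‖ = ‖f‖
    rw [dilationFun, Lp.norm_toLp, (eLpNorm_comp_smul hθ f).2, Lp.norm_def]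

theorem dilation_ae {n : ℕ} (θ : ℝ) (hθ : 0 < θ) (f : L2 n) :
    dilation θ hθ f =ᵐ[volume] fun x => ((θ ^ ((n : ℝ) / 2) : ℝ) : ℂ) * f (θ • x) :=
  dilationFun_ae hθ f

/-! ### Schrödinger operators -/

theorem coe_add {n : ℕ} (u v : L2 n) :
    ((u + v : L2 n) : 𝓢'(EuclideanSpace ℝ (Fin n), ℂ)) = u + v :=
  map_add (Lp.toTemperedDistributionCLM ℂ volume 2) u v

theorem coe_smul {n : ℕ} (c : ℂ) (u : L2 n) :
    ((c • u : L2 n) : 𝓢'(EuclideanSpace ℝ (Fin n), ℂ)) = c • u :=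
  map_smul (Lp.toTemperedDistributionCLM ℂ volume 2) c u

theorem coe_zero {n : ℕ} : ((0 : L2 n) : 𝓢'(EuclideanSpace ℝ (Fin n), ℂ)) = 0 :=
  map_zero (Lp.toTemperedDistributionCLM ℂ volume 2)

theorem coe_inj {n : ℕ} (u : L2 n) (h : (u : 𝓢'(EuclideanSpace ℝ (Fin n), ℂ)) = 0) : u = 0 :=
  LinearMap.ker_eq_bot'.1 (Lp.ker_toTemperedDistributionCLM_eq_bot (F := ℂ) (p := 2)
    (μ := (volume : Measure (EuclideanSpace ℝ (Fin n))))) u h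

/-- `f = -a Δ u + V u` for `u ∈ H²(ℝⁿ) ∩ D(V)`: here `D(V) = {u ∈ L² | V u ∈ L²}`, the Laplacian
is the distributional one, and `MemSobolev 2 2` is membership in the Sobolev space `H²(ℝⁿ)`. -/
def IsSchrodinger {n : ℕ} (a : ℝ) (V : EuclideanSpace ℝ (Fin n) → ℝ) (u f : L2 n) : Prop :=
  MemSobolev 2 2 (u : 𝓢'(EuclideanSpace ℝ (Fin n), ℂ)) ∧
    ∃ g : L2 n, g =ᵐ[volume] (fun x => (V x : ℂ) * u x) ∧
      (f : 𝓢'(EuclideanSpace ℝ (Fin n), ℂ)) =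
        -((a : ℂ) • Δ (u : 𝓢'(EuclideanSpace ℝ (Fin n), ℂ))) + g

theorem IsSchrodinger.add {n : ℕ} {a : ℝ} {V : EuclideanSpace ℝ (Fin n) → ℝ} {u v f g : L2 n}
    (h : IsSchrodinger a V u f) (h' : IsSchrodinger a V v g) :
    IsSchrodinger a V (u + v) (f + g) := by
  obtain ⟨hu, p, hp, hf⟩ := h
  obtain ⟨hv, q, hq, hg⟩ := h'
  refine ⟨coe_add u v ▸ hu.add hv, p + q, ?_, ?_⟩
  · filter_upwards [Lp.coeFn_add u v, Lp.coeFn_add p q, hp, hq] with x h1 h2 h3 h4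
    rw [h1, h2, Pi.add_apply, Pi.add_apply, h3, h4, mul_add]
  · have h1 := map_add (LineDeriv.laplacianCLM ℂ (EuclideanSpace ℝ (Fin n))
      𝓢'(EuclideanSpace ℝ (Fin n), ℂ)) (Lp.toTemperedDistribution u)
        (Lp.toTemperedDistribution v)
    simp only [laplacianCLM_apply] at h1
    rw [coe_add, coe_add, coe_add, hf, hg, h1, smul_add]
    abel

theorem IsSchrodinger.smul {n : ℕ} {a : ℝ} {V : EuclideanSpace ℝ (Fin n) → ℝ} {u f : L2 n}
    (c : ℂ) (h : IsSchrodinger a V u f) : IsSchrodinger a V (c • u) (c • f) := by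
  obtain ⟨hu, p, hp, hf⟩ := h
  refine ⟨coe_smul c u ▸ hu.smul c, c • p, ?_, ?_⟩
  · filter_upwards [Lp.coeFn_smul c u, Lp.coeFn_smul c p, hp] with x h1 h2 h3
    rw [h1, h2, Pi.smul_apply, Pi.smul_apply, h3, smul_eq_mul, smul_eq_mul, mul_left_comm]
  · have h1 := map_smul (LineDeriv.laplacianCLM ℂ (EuclideanSpace ℝ (Fin n))
      𝓢'(EuclideanSpace ℝ (Fin n), ℂ)) c (Lp.toTemperedDistribution u)
    simp only [laplacianCLM_apply] at h1
    rw [coe_smul, coe_smul, coe_smul, hf, h1, smul_add, smul_neg, smul_comm c (a : ℂ)]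

theorem IsSchrodinger.zero {n : ℕ} (a : ℝ) (V : EuclideanSpace ℝ (Fin n) → ℝ) :
    IsSchrodinger a V 0 0 := by
  have h1 := map_zero (LineDeriv.laplacianCLM ℂ (EuclideanSpace ℝ (Fin n))
    𝓢'(EuclideanSpace ℝ (Fin n), ℂ))
  simp only [laplacianCLM_apply] at h1
  refine ⟨coe_zero (n := n) ▸ memSobolev_fun_zero _ _ 2 2, 0, ?_, ?_⟩
  · filter_upwards [Lp.coeFn_zero ℂ 2 (volume : Measure (EuclideanSpace ℝ (Fin n)))] with x hx
    rw [hx, Pi.zero_apply, mul_zero]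
  · rw [coe_zero, h1, smul_zero, neg_zero, add_zero]

theorem IsSchrodinger.eq_zero {n : ℕ} {a : ℝ} {V : EuclideanSpace ℝ (Fin n) → ℝ} {f : L2 n}
    (h : IsSchrodinger a V 0 f) : f = 0 := by
  obtain ⟨-, p, hp, hf⟩ := h
  have h1 := map_zero (LineDeriv.laplacianCLM ℂ (EuclideanSpace ℝ (Fin n))
    𝓢'(EuclideanSpace ℝ (Fin n), ℂ))
  simp only [laplacianCLM_apply] at h1
  have hp0 : p = 0 := by
    apply Lp.ext
    filter_upwards [hp, Lp.coeFn_zero ℂ 2 (volume : Measure (EuclideanSpace ℝ (Fin n)))]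
      with x h2 h3
    rw [h2, h3, Pi.zero_apply, mul_zero]
  rw [hp0, coe_zero, h1, smul_zero, neg_zero, add_zero] at hf
  exact coe_inj f hf

/-- The graph of `-a Δ + V` on `H²(ℝⁿ) ∩ D(V)`. -/
def schrodingerGraph {n : ℕ} (a : ℝ) (V : EuclideanSpace ℝ (Fin n) → ℝ) :
    Submodule ℂ (L2 n × L2 n) where
  carrier := {p | IsSchrodinger a V p.1 p.2}
  zero_mem' := IsSchrodinger.zero a V
  add_mem' := IsSchrodinger.add
  smul_mem' c _ h := IsSchrodinger.smul c h

/-- The operator `-a Δ + V` on `L²(ℝⁿ)` with domain `H²(ℝⁿ) ∩ D(V)`. -/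
def schrodinger {n : ℕ} (a : ℝ) (V : EuclideanSpace ℝ (Fin n) → ℝ) : L2 n →ₗ.[ℂ] L2 n :=
  (schrodingerGraph a V).toLinearPMap

theorem mem_graph_schrodinger {n : ℕ} (a : ℝ) (V : EuclideanSpace ℝ (Fin n) → ℝ) (u f : L2 n) :
    (u, f) ∈ (schrodinger a V).graph ↔ IsSchrodinger a V u f := by
  have h : (schrodinger a V).graph = schrodingerGraph a V := by
    apply Submodule.toLinearPMap_graph_eq
    rintro ⟨u, f⟩ h (rfl : u = 0)
    exact IsSchrodinger.eq_zero h
  rw [h]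
  rfl

theorem mem_domain_schrodinger {n : ℕ} (a : ℝ) (V : EuclideanSpace ℝ (Fin n) → ℝ) (u : L2 n) :
    u ∈ (schrodinger a V).domain ↔
      MemSobolev 2 2 (u : 𝓢'(EuclideanSpace ℝ (Fin n), ℂ)) ∧
        MemLp (fun x => (V x : ℂ) * u x) 2 volume := by
  rw [LinearPMap.mem_domain_iff]
  simp only [mem_graph_schrodinger]
  constructor
  · rintro ⟨f, hu, g, hg, -⟩
    exact ⟨hu, (memLp_congr_ae hg).1 (Lp.memLp g)⟩
  · rintro ⟨hu, hV⟩
    have hL := hu.laplacian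
    rw [sub_self] at hL
    obtain ⟨g, hg⟩ := hL
    rw [besselPotential_zero] at hg
    have hg' : Δ (u : 𝓢'(EuclideanSpace ℝ (Fin n), ℂ)) = g := hg
    refine ⟨(-(a : ℂ)) • g + hV.toLp _, hu, hV.toLp _, hV.coeFn_toLp, ?_⟩
    rw [coe_add, coe_smul, hg', neg_smul]

/-- The quadratic form `⟨Ax, x⟩ = ∑ᵢⱼ aᵢⱼ xᵢ xⱼ`. -/
def quadForm {n : ℕ} (A : Matrix (Fin n) (Fin n) ℝ) (x : EuclideanSpace ℝ (Fin n)) : ℝ :=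
  ∑ i, ∑ j, A i j * x i * x j

/-- The harmonic oscillator `K(lam) = -Δ + lam² ⟨Ax, x⟩`. -/
def oscillator {n : ℕ} (A : Matrix (Fin n) (Fin n) ℝ) (lam : ℝ) : L2 n →ₗ.[ℂ] L2 n :=
  schrodinger 1 fun x => lam ^ 2 * quadForm A x

/-- The harmonic oscillator `K = -Δ + ⟨Ax, x⟩`. -/
def oscillatorK {n : ℕ} (A : Matrix (Fin n) (Fin n) ℝ) : L2 n →ₗ.[ℂ] L2 n :=
  schrodinger 1 (quadForm A)

/-- The semiclassical oscillator `P(h) = -h² Δ + ⟨Ax, x⟩`. -/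
def semiclassical {n : ℕ} (A : Matrix (Fin n) (Fin n) ℝ) (h : ℝ) : L2 n →ₗ.[ℂ] L2 n :=
  schrodinger (h ^ 2) (quadForm A)

end

end HarmonicOscillator

end

/-! In an orthonormal eigenbasis of `A`, each operator in play is -h²Δ + ∑ wᵢ²xᵢ² for suitable h and
frequencies: h = 1 with wᵢ for K, h = 1 with λwᵢ for K(λ), and h with wᵢ for P(h). One analysis
covers all three.

The ladder operators wᵢxᵢ ∓ h∂ᵢ generate from the Gaussian G = exp(-∑ wᵢxᵢ²/(2h)) an orthogonal
family of Schwartz eigenfunctions with eigenvalues ∑ (2mᵢ+1)hwᵢ. The family is complete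
(`eq_zero_of_inner_state_eq_zero`): if f is orthogonal to it, all moments of f·G vanish, hence so
does its Fourier transform, hence f.

It remains to handle the prescribed domain H² ∩ D(V). Integration by parts puts the operator inside
the adjoint of its restriction to Schwartz functions, and the estimate ‖Vu‖² ≤ ‖Hu‖² + C‖u‖² shows
that it contains the closure of that restriction. The eigenbasis forces closure and adjoint to
coincide (`isDiagonal_of_core`). So the operator is diagonal with finitely many energies below each
bound, which gives the spectrum and its discreteness. Its graph is also described by testing against
Schwartz functions, which reduces the dilation equivalence, domains included, to a scaling identity
on Schwartz functions (`schwartzDilation_hamiltonian`). -/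

noncomputable section

/-! ### Spectral theory of operators diagonal in a Hilbert basis. -/

section

namespace LinearPMap

variable {H : Type*} [NormedAddCommGroup H] [InnerProductSpace ℂ H]

/-- Spectral notions are rephrased through the graph, which avoids dependent domain proofs;
diagonality and unitary conjugation are graph statements too. -/
theorem mem_preimageSub_iff (T : H →ₗ.[ℂ] H) (z : ℂ) (W : Submodule ℂ H) (u : H) :
    u ∈ preimageSub T z W ↔ ∃ f, (u, f) ∈ T.graph ∧ f - z • u ∈ W := by
  constructor
  · rintro ⟨hu, h⟩
    exact ⟨_, T.mem_graph ⟨u, hu⟩, h⟩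
  · rintro ⟨f, hf, h⟩
    have hu := LinearPMap.mem_domain_of_mem_graph hf
    refine ⟨hu, ?_⟩
    rwa [← (LinearPMap.image_iff hu).2 hf]

theorem mem_eigenspace_iff (T : H →ₗ.[ℂ] H) (z : ℂ) (u : H) :
    u ∈ eigenspace T z ↔ (u, z • u) ∈ T.graph := by
  rw [eigenspace, mem_preimageSub_iff]
  constructor
  · rintro ⟨f, hf, h⟩
    rw [Submodule.mem_bot, sub_eq_zero] at h
    rwa [← h]
  · exact fun h => ⟨_, h, by simp⟩

theorem mem_opResolventSet_iff (T : H →ₗ.[ℂ] H) (z : ℂ) :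
    z ∈ opResolventSet T ↔ ∃ R : H →L[ℂ] H, (∀ f, (R f, f + z • R f) ∈ T.graph) ∧
      ∀ u f, (u, f) ∈ T.graph → R (f - z • u) = u := by
  refine exists_congr fun R => and_congr (forall_congr' fun f => ?_) ?_
  · constructor
    · rintro ⟨hf, h⟩
      rw [← LinearPMap.image_iff hf]
      exact (sub_eq_iff_eq_add.1 h).symm
    · intro h
      have hf := LinearPMap.mem_domain_of_mem_graph h
      exact ⟨hf, by rw [← (LinearPMap.image_iff hf).2 h, add_sub_cancel_right]⟩
  · constructor
    · intro h u f huf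
      have hu := LinearPMap.mem_domain_of_mem_graph huf
      have := h ⟨u, hu⟩
      rwa [← (LinearPMap.image_iff hu).2 huf] at this
    · exact fun h u => h _ _ (T.mem_graph u)

end LinearPMap

namespace HilbertBasis

variable {ι H : Type*} [NormedAddCommGroup H] [InnerProductSpace ℂ H]

/-- The bounded operator with bounded eigenvalues `d i` on the Hilbert basis `β`. -/
theorem exists_diagonal (β : HilbertBasis ι ℂ H) (d : ι → ℂ) (C : ℝ) (hd : ∀ i, ‖d i‖ ≤ C) :
    ∃ R : H →L[ℂ] H, ∀ f i, inner ℂ (β i) (R f) = d i * inner ℂ (β i) f := by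
  have hmem : ∀ f : lp (fun _ : ι => ℂ) 2, Memℓp (fun i => d i * f i) 2 := fun f => by
    have h1 : Memℓp (fun i => C * ‖f i‖) 2 := (lp.memℓp f).norm.const_mul C
    rw [memℓp_gen_iff (by norm_num)] at h1 ⊢
    refine h1.of_nonneg_of_le (fun i => by positivity) fun i => ?_
    gcongr
    rw [norm_mul, norm_mul, norm_norm]
    gcongr
    exact (hd i).trans (le_abs_self C)
  have hnorm : ∀ f : lp (fun _ : ι => ℂ) 2,
      ‖(⟨fun i => d i * f i, hmem f⟩ : lp (fun _ : ι => ℂ) 2)‖ ≤ |C| * ‖f‖ := fun f => by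
    refine lp.norm_le_of_forall_sum_le (by norm_num) (by positivity) fun s => ?_
    have h2 := lp.sum_rpow_le_norm_rpow (p := 2) (by norm_num) f s
    rw [Real.mul_rpow (abs_nonneg _) (norm_nonneg _)]
    refine le_trans ?_ (mul_le_mul_of_nonneg_left h2 (by positivity))
    rw [Finset.mul_sum]
    refine Finset.sum_le_sum fun i _ => ?_
    rw [← Real.mul_rpow (abs_nonneg _) (norm_nonneg _)]
    gcongr
    change ‖d i * f i‖ ≤ _
    rw [norm_mul]
    gcongr
    exact (hd i).trans (le_abs_self C)
  let L : lp (fun _ : ι => ℂ) 2 →L[ℂ] lp (fun _ : ι => ℂ) 2 := LinearMap.mkContinuous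
    { toFun := fun f => ⟨fun i => d i * f i, hmem f⟩
      map_add' := fun f g => by ext i; exact mul_add _ _ _
      map_smul' := fun c f => by ext i; exact mul_left_comm _ _ _ } |C| hnorm
  let e : H ≃L[ℂ] lp (fun _ : ι => ℂ) 2 := β.repr.toContinuousLinearEquiv
  refine ⟨(e.symm : lp (fun _ : ι => ℂ) 2 →L[ℂ] H) ∘L L ∘L (e : H →L[ℂ] _), fun f i => ?_⟩
  rw [← β.repr_apply_apply, ← β.repr_apply_apply]
  change β.repr (β.repr.symm (L (β.repr f))) i = _
  rw [LinearIsometryEquiv.apply_symm_apply]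
  rfl

theorem ext_inner_left (β : HilbertBasis ι ℂ H) {u v : H} (h : ∀ i, inner ℂ (β i) u = inner ℂ (β i) v) :
    u = v :=
  β.repr.injective (lp.ext (funext fun i => by rw [β.repr_apply_apply, β.repr_apply_apply, h]))

/-- The vectors supported on finitely many elements of a Hilbert basis. -/
theorem finiteDimensional_of_le (β : HilbertBasis ι ℂ H) {F : Set ι} (hF : F.Finite)
    (M : Submodule ℂ H) (hM : ∀ u ∈ M, ∀ i ∉ F, inner ℂ (β i) u = 0) : FiniteDimensional ℂ M := by
  have := hF.to_subtype
  let g : M →ₗ[ℂ] (F → ℂ) :=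
    { toFun := fun u i => inner ℂ (β i) (u : H)
      map_add' := fun u v => by ext i; simp
      map_smul' := fun c u => by ext i; simp }
  refine FiniteDimensional.of_injective g fun u v huv => Subtype.ext (β.ext_inner_left fun i => ?_)
  by_cases hi : i ∈ F
  · exact congrFun huv ⟨i, hi⟩
  · rw [hM u u.2 i hi, hM v v.2 i hi]

end HilbertBasis

namespace LinearPMap

variable {ι H : Type*} [NormedAddCommGroup H] [InnerProductSpace ℂ H]

/-- `T` is the maximal operator that acts diagonally on a Hilbert basis, with real eigenvalues. -/
def IsDiagonal (T : H →ₗ.[ℂ] H) (β : HilbertBasis ι ℂ H) (E : ι → ℝ) : Prop :=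
  ∀ u f, (u, f) ∈ T.graph ↔ ∀ i, inner ℂ (β i) f = E i * inner ℂ (β i) u

namespace IsDiagonal

variable {T : H →ₗ.[ℂ] H} {β : HilbertBasis ι ℂ H} {E : ι → ℝ}

theorem mem_graph_basis (h : IsDiagonal T β E) (i : ι) : (β i, (E i : ℂ) • β i) ∈ T.graph := by
  classical
  rw [h]
  intro k
  rw [inner_smul_right, orthonormal_iff_ite.1 β.orthonormal]
  split_ifs with hk
  · rw [hk]
  · simp

theorem basis_ne_zero (β : HilbertBasis ι ℂ H) (i : ι) : β i ≠ 0 := by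
  have := β.orthonormal.1 i
  rintro h
  simp [h] at this

theorem eigenvalue_mem_opSpectrum (h : IsDiagonal T β E) (i : ι) : (E i : ℂ) ∈ opSpectrum T := by
  intro hz
  obtain ⟨R, -, hR⟩ := (mem_opResolventSet_iff _ _).1 hz
  have := hR _ _ (h.mem_graph_basis i)
  rw [sub_self, R.map_zero] at this
  exact basis_ne_zero β i this.symm

/-- Eigenvalues with `|E i| > ‖z‖ + 1` are at distance at least 1 from `z`; finitely many indices
remain, and a minimum over them exists. -/
theorem exists_pos_le_dist (hfin : ∀ r, {i | |E i| ≤ r}.Finite) (z : ℂ) :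
    ∃ ε > 0, ∀ i, (E i : ℂ) ≠ z → ε ≤ dist (E i : ℂ) z := by
  have hF := hfin (‖z‖ + 1)
  have h1 : ∀ i, ∃ δ > 0, (E i : ℂ) ≠ z → δ ≤ dist (E i : ℂ) z := fun i => by
    by_cases hi : (E i : ℂ) = z
    · exact ⟨1, one_pos, fun h => absurd hi h⟩
    · exact ⟨_, dist_pos.2 hi, fun _ => le_rfl⟩
  choose δ hδ hδ' using h1
  obtain ⟨ε, hε, hε'⟩ : ∃ ε > 0, ∀ i ∈ hF.toFinset, ε ≤ δ i := by
    by_cases hne : hF.toFinset.Nonempty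
    · obtain ⟨i, hi, hmin⟩ := Finset.exists_min_image _ δ hne
      exact ⟨δ i, hδ i, hmin⟩
    · rw [Finset.not_nonempty_iff_eq_empty] at hne
      exact ⟨1, one_pos, by simp [hne]⟩
  refine ⟨min ε 1, by positivity, fun i hi => ?_⟩
  by_cases hiF : i ∈ hF.toFinset
  · exact (min_le_left _ _).trans ((hε' i hiF).trans (hδ' i hi))
  · have h2 : ‖z‖ + 1 < |E i| := by simpa using hiF
    have h3 := norm_sub_norm_le (E i : ℂ) z
    rw [Complex.norm_real, Real.norm_eq_abs] at h3
    rw [dist_eq_norm]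
    exact (min_le_right _ _).trans (by linarith)

theorem opSpectrum_eq (h : IsDiagonal T β E) (hfin : ∀ r, {i | |E i| ≤ r}.Finite) :
    opSpectrum T = Set.range fun i => (E i : ℂ) := by
  refine Set.Subset.antisymm (fun z hz => ?_) ?_
  · by_contra hzE
    have hne : ∀ i, (E i : ℂ) ≠ z := fun i hi => hzE ⟨i, hi⟩
    obtain ⟨ε, hε, hdist⟩ := exists_pos_le_dist hfin z
    -- Off the eigenvalues the resolvent is the diagonal operator with entries 1/(Eᵢ - z), bounded
    -- because the distances to `z` are at least `ε`.
    obtain ⟨R, hR⟩ := β.exists_diagonal (fun i => ((E i : ℂ) - z)⁻¹) ε⁻¹ fun i => by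
      rw [norm_inv]
      gcongr
      simpa [dist_eq_norm] using hdist i (hne i)
    refine hz ((mem_opResolventSet_iff _ _).2 ⟨R, fun f => ?_, fun u f huf => ?_⟩)
    · rw [h]
      intro i
      have h0 := sub_ne_zero.2 (hne i)
      rw [inner_add_right, inner_smul_right, hR]
      field_simp
      ring
    · refine β.ext_inner_left fun i => ?_
      have h0 := sub_ne_zero.2 (hne i)
      rw [hR, inner_sub_right, inner_smul_right, (h u f).1 huf i]
      field_simp
  · rintro _ ⟨i, rfl⟩
    exact h.eigenvalue_mem_opSpectrum i

/-- The i-th coefficient of (T - z)v is (Eᵢ - z) times that of v, so its vanishing passes from one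
power of the kernel to the next. Hence generalized eigenvectors are supported on the indices with Eᵢ
= z. -/
theorem inner_eq_zero_of_mem_genEigenspace (h : IsDiagonal T β E) (z : ℂ) (u : H)
    (hu : u ∈ genEigenspace T z) (i : ι) (hi : (E i : ℂ) ≠ z) : inner ℂ (β i) u = 0 := by
  let M : Submodule ℂ H :=
    { carrier := {u | inner ℂ (β i) u = 0}
      zero_mem' := by simp
      add_mem' := fun {a b} ha hb => by
        have ha' : inner ℂ (β i) a = 0 := ha
        have hb' : inner ℂ (β i) b = 0 := hb
        simp [ha', hb']
      smul_mem' := fun c a ha => by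
        have ha' : inner ℂ (β i) a = 0 := ha
        simp [ha'] }
  suffices genEigenspace T z ≤ M from this hu
  refine iSup_le fun k => ?_
  induction k with
  | zero => exact bot_le
  | succ k ih =>
    rw [Function.iterate_succ_apply']
    intro v hv
    obtain ⟨f, hf, hfv⟩ := (mem_preimageSub_iff _ _ _ _).1 hv
    have h1 : inner ℂ (β i) (f - z • v) = 0 := ih hfv
    rw [inner_sub_right, inner_smul_right, (h v f).1 hf i, ← sub_mul] at h1
    exact (mul_eq_zero.1 h1).resolve_left (sub_ne_zero.2 hi)

theorem hasPurelyDiscreteSpectrum (h : IsDiagonal T β E) (hfin : ∀ r, {i | |E i| ≤ r}.Finite) :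
    HasPurelyDiscreteSpectrum T := by
  refine Set.sdiff_eq_empty.2 fun z hz => ⟨hz, ?_, ?_, ?_⟩
  · obtain ⟨i, rfl⟩ := (h.opSpectrum_eq hfin) ▸ hz
    exact (Submodule.ne_bot_iff _).2
      ⟨β i, (mem_eigenspace_iff _ _ _).2 (h.mem_graph_basis i), basis_ne_zero β i⟩
  · refine β.finiteDimensional_of_le (F := {i | (E i : ℂ) = z})
      ((hfin ‖z‖).subset fun i hi => ?_) _ fun u hu i hi =>
        h.inner_eq_zero_of_mem_genEigenspace z u hu i hi
    have hi' : (E i : ℂ) = z := hi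
    simp [← hi']
  · obtain ⟨ε, hε, hdist⟩ := exists_pos_le_dist hfin z
    refine ⟨ε, hε, fun z' hz' hne => ?_⟩
    obtain ⟨i, rfl⟩ := (h.opSpectrum_eq hfin) ▸ hz'
    exact hdist i hne

end IsDiagonal

end LinearPMap

end

/-! ### Ladder operators from the canonical commutation relations. -/

section

/-- Position operators `X i` and derivatives `D i` on a space `S` of test functions that is embedded
in a Hilbert space by `j`: they satisfy the canonical commutation relations, the `X i` are symmetric
and the `D i` are antisymmetric. -/
structure CanonicalPair (ι S H : Type*) [DecidableEq ι] [AddCommGroup S] [Module ℂ S]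
    [NormedAddCommGroup H] [InnerProductSpace ℂ H] where
  X : ι → Module.End ℂ S
  D : ι → Module.End ℂ S
  j : S →ₗ[ℂ] H
  j_injective : Function.Injective j
  X_comm : ∀ i k, X i * X k = X k * X i
  D_comm : ∀ i k, D i * D k = D k * D i
  D_X : ∀ i k, D i * X k = X k * D i + if i = k then 1 else 0
  X_symm : ∀ i u v, inner ℂ (j (X i u)) (j v) = inner ℂ (j u) (j (X i v))
  D_skew : ∀ i u v, inner ℂ (j (D i u)) (j v) = -inner ℂ (j u) (j (D i v))

namespace CanonicalPair

variable {ι S H : Type*} [DecidableEq ι] [AddCommGroup S] [Module ℂ S]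
  [NormedAddCommGroup H] [InnerProductSpace ℂ H] (P : CanonicalPair ι S H) (h : ℝ) (w : ι → ℝ)

/-- The creation operators. -/
def creation (i : ι) : Module.End ℂ S := (w i : ℂ) • P.X i - (h : ℂ) • P.D i

/-- The annihilation operators. -/
def annihilation (i : ι) : Module.End ℂ S := (w i : ℂ) • P.X i + (h : ℂ) • P.D i

theorem creation_comm (i k : ι) :
    P.creation h w i * P.creation h w k = P.creation h w k * P.creation h w i := by
  rcases eq_or_ne i k with rfl | hik
  · rfl
  · simp only [creation, mul_sub, sub_mul, smul_mul_smul_comm, P.D_X, hik, hik.symm, if_false,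
      P.X_comm i k, P.D_comm i k]
    module

theorem annihilation_mul_creation (i k : ι) :
    P.annihilation h w i * P.creation h w k = P.creation h w k * P.annihilation h w i +
      if i = k then ((2 * h * w i : ℝ) : ℂ) • 1 else 0 := by
  simp only [annihilation, creation, mul_sub, sub_mul, mul_add, add_mul, smul_mul_smul_comm, P.D_X,
    P.X_comm i k, P.D_comm i k]
  rcases eq_or_ne i k with rfl | hik
  · simp only [if_true]
    push_cast
    module
  · simp only [hik, hik.symm, if_false]
    module

theorem inner_creation_left (i : ι) (u v : S) :
    inner ℂ (P.j (P.creation h w i u)) (P.j v) =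
      inner ℂ (P.j u) (P.j (P.annihilation h w i v)) := by
  simp [creation, annihilation, P.X_symm, P.D_skew]

theorem inner_annihilation_left (i : ι) (u v : S) :
    inner ℂ (P.j (P.annihilation h w i u)) (P.j v) =
      inner ℂ (P.j u) (P.j (P.creation h w i v)) := by
  rw [← inner_conj_symm, ← inner_creation_left, inner_conj_symm]

/-- Moving one D across and commuting it past both X's gives -‖X_k D_i u‖² - 2δᵢₖ Re⟨X_k D_i u, u⟩;
completing the square leaves at most ‖u‖². -/
theorem re_inner_D_sq_X_sq_le (i k : ι) (u : S) :
    (inner ℂ (P.j (P.D i (P.D i u))) (P.j (P.X k (P.X k u)))).re ≤ ‖P.j u‖ ^ 2 := by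
  have hD : ∀ v, P.D i (P.X k v) = P.X k (P.D i v) + if i = k then v else 0 := fun v => by
    have := congrArg (fun A : Module.End ℂ S => A v) (P.D_X i k)
    simp only [Module.End.mul_apply, LinearMap.add_apply] at this
    rw [this]
    split_ifs <;> rfl
  rw [P.D_skew, hD, hD]
  have h1 := abs_le.1 (Complex.abs_re_le_norm (inner ℂ (P.j (P.X k (P.D i u))) (P.j u)))
  have h2 := norm_inner_le_norm (𝕜 := ℂ) (P.j (P.X k (P.D i u))) (P.j u)
  have h3 : (inner ℂ (P.j (P.X k (P.X k (P.D i u)))) (P.j (P.D i u))).re =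
      ‖P.j (P.X k (P.D i u))‖ ^ 2 := by
    rw [P.X_symm]
    exact inner_self_eq_norm_sq (𝕜 := ℂ) _
  split_ifs
  · simp only [map_add, inner_add_right, ← P.X_symm, Complex.neg_re, Complex.add_re, h3]
    nlinarith [sq_nonneg (‖P.j (P.X k (P.D i u))‖ - ‖P.j u‖)]
  · simp only [add_zero, ← P.X_symm, Complex.neg_re, h3]
    nlinarith [sq_nonneg ‖P.j (P.X k (P.D i u))‖, sq_nonneg ‖P.j u‖]

section Fintype

variable [Fintype ι]

/-- The kinetic energy `-h² ∑ Dᵢ²`. -/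
def kinetic : Module.End ℂ S := -∑ i, ((h ^ 2 : ℝ) : ℂ) • (P.D i * P.D i)

/-- The potential energy `∑ wᵢ² Xᵢ²`. -/
def potential : Module.End ℂ S := ∑ i, ((w i ^ 2 : ℝ) : ℂ) • (P.X i * P.X i)

/-- The Hamiltonian `∑ (-h² Dᵢ² + wᵢ² Xᵢ²)` of the harmonic oscillator. -/
def hamiltonian : Module.End ℂ S := P.kinetic h + P.potential w

/-- In cᵢaᵢ the cross terms leave the commutator [Dᵢ, Xᵢ] = 1, and this produces the zero-point
energy hwᵢ. -/
theorem hamiltonian_eq_sum : P.hamiltonian h w =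
    ∑ i, (P.creation h w i * P.annihilation h w i + ((h * w i : ℝ) : ℂ) • 1) := by
  rw [hamiltonian, kinetic, potential, ← Finset.sum_neg_distrib, ← Finset.sum_add_distrib]
  refine Finset.sum_congr rfl fun i _ => ?_
  simp only [annihilation, creation, sub_mul, mul_add, smul_mul_smul_comm, P.D_X, if_true]
  push_cast
  module

/-- The potential energy is bounded relative to the Hamiltonian. -/
theorem norm_potential_sq_le (u : S) :
    ‖P.j (P.potential w u)‖ ^ 2 ≤ ‖P.j (P.hamiltonian h w u)‖ ^ 2 +
      2 * (∑ k, ∑ _i : ι, h ^ 2 * w k ^ 2) * ‖P.j u‖ ^ 2 := by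
  -- The cross term of ‖Tu + Vu‖², with T kinetic and V potential, is bounded below; the square
  -- ‖Tu‖² can then be dropped.
  have h1 : -((∑ k, ∑ _i : ι, h ^ 2 * w k ^ 2) * ‖P.j u‖ ^ 2) ≤
      (inner ℂ (P.j (P.kinetic h u)) (P.j (P.potential w u))).re := by
    simp only [kinetic, potential, LinearMap.neg_apply, LinearMap.sum_apply, LinearMap.smul_apply,
      map_neg, map_sum, map_smul, inner_neg_left, sum_inner, inner_sum, inner_smul_left,
      inner_smul_right, Finset.sum_mul, Module.End.mul_apply]
    rw [← Finset.sum_neg_distrib, Complex.re_sum]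
    refine Finset.sum_le_sum fun k _ => ?_
    rw [Complex.re_ofReal_mul, Complex.neg_re, Complex.re_sum, mul_neg, Finset.mul_sum]
    refine neg_le_neg (Finset.sum_le_sum fun i _ => ?_)
    rw [Complex.conj_ofReal, Complex.re_ofReal_mul]
    have := mul_le_mul_of_nonneg_left (P.re_inner_D_sq_X_sq_le i k u)
      (show 0 ≤ h ^ 2 * w k ^ 2 by positivity)
    linarith
  have h2 := norm_add_sq (𝕜 := ℂ) (P.j (P.kinetic h u)) (P.j (P.potential w u))
  rw [← map_add, ← LinearMap.add_apply, ← hamiltonian] at h2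
  have h3 : RCLike.re (inner ℂ (P.j (P.kinetic h u)) (P.j (P.potential w u))) =
    (inner ℂ (P.j (P.kinetic h u)) (P.j (P.potential w u))).re := rfl
  rw [h3] at h2
  nlinarith [sq_nonneg ‖P.j (P.kinetic h u)‖]

end Fintype

section States

variable [Fintype ι] (G : S)

/-- The excited state `∏ᵢ cᵢ ^ mᵢ G` over the ground state `G`. -/
def state (m : ι → ℕ) : S :=
  MonoidHom.noncommPiCoprod (fun i => powersHom (Module.End ℂ S) (P.creation h w i))
    (fun i k _ x y => by
      simpa only [powersHom_apply] using
        Commute.pow_pow (show Commute _ _ from P.creation_comm h w i k) _ _)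
    (fun i => Multiplicative.ofAdd (m i)) G

theorem state_zero : P.state h w G 0 = G := by
  rw [state]
  erw [map_one]
  rfl

theorem state_add_single (m : ι → ℕ) (i : ι) :
    P.state h w G (m + Pi.single i 1) = P.creation h w i (P.state h w G m) := by
  have hm : (fun k => Multiplicative.ofAdd ((m + Pi.single i 1 : ι → ℕ) k)) =
      Pi.mulSingle (M := fun _ => Multiplicative ℕ) i (Multiplicative.ofAdd 1) *
        fun k => Multiplicative.ofAdd (m k) := by
    funext k
    rcases eq_or_ne k i with rfl | hk
    · simp [mul_comm]
    · simp [hk]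
  rw [state, hm, map_mul, Module.End.mul_apply]
  erw [MonoidHom.noncommPiCoprod_mulSingle]
  simp [state]

/-- Induction on ∑ mᵢ: every state is reached from the ground state by one excitation at a time. -/
theorem _root_.Pi.nat_induction {p : (ι → ℕ) → Prop} (h0 : p 0)
    (h1 : ∀ m i, p m → p (m + Pi.single i 1)) (m : ι → ℕ) : p m := by
  induction hN : ∑ i, m i generalizing m with
  | zero =>
    have : m = 0 := funext fun i => by simpa using (Finset.sum_eq_zero_iff.1 hN) i
    exact this ▸ h0
  | succ N ih =>
    obtain ⟨i, hi⟩ : ∃ i, m i ≠ 0 := by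
      by_contra! hm
      simp [hm] at hN
    have hle : (Pi.single i 1 : ι → ℕ) ≤ m := by
      intro k
      rcases eq_or_ne k i with rfl | hk
      · simp only [Pi.single_eq_same]
        omega
      · simp [hk]
    have hm : m - Pi.single i 1 + Pi.single i 1 = m := tsub_add_cancel_of_le hle
    rw [← hm]
    refine h1 _ _ (ih _ ?_)
    have h2 := congrArg (fun f : ι → ℕ => ∑ i, f i) hm
    simp only [Pi.add_apply, Finset.sum_add_distrib, hN, Finset.sum_pi_single',
      Finset.mem_univ, if_true] at h2
    omega

variable {G} {h} {w}

/-- Commuting aᵢ past each creation operator cᵢ contributes 2hwᵢ, until aᵢ reaches the ground state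
and kills it. -/
theorem number_state (hG : ∀ i, P.annihilation h w i G = 0) (i : ι) (m : ι → ℕ) :
    P.creation h w i (P.annihilation h w i (P.state h w G m)) =
      ((2 * h * w i * m i : ℝ) : ℂ) • P.state h w G m := by
  induction m using Pi.nat_induction with
  | h0 => simp [state_zero, hG]
  | h1 m k ih =>
    have h1 := congrArg (fun A : Module.End ℂ S => A (P.state h w G m))
      (P.annihilation_mul_creation h w i k)
    have h2 := congrArg (fun A : Module.End ℂ S => A (P.annihilation h w i (P.state h w G m)))
      (P.creation_comm h w i k)
    simp only [Module.End.mul_apply, LinearMap.add_apply] at h1 h2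
    rw [state_add_single, h1, map_add, h2, ih]
    rcases eq_or_ne i k with rfl | hik
    · simp only [if_true, LinearMap.smul_apply, Module.End.one_apply, map_smul, ← add_smul,
        Pi.add_apply, Pi.single_eq_same]
      congr 1
      push_cast
      ring
    · simp [hik]

theorem hamiltonian_state (hG : ∀ i, P.annihilation h w i G = 0) (m : ι → ℕ) :
    P.hamiltonian h w (P.state h w G m) =
      ((∑ i, (2 * (m i : ℝ) + 1) * h * w i : ℝ) : ℂ) • P.state h w G m := by
  rw [hamiltonian_eq_sum, LinearMap.sum_apply, Complex.ofReal_sum, Finset.sum_smul]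
  refine Finset.sum_congr rfl fun i _ => ?_
  rw [LinearMap.add_apply, Module.End.mul_apply, P.number_state hG, LinearMap.smul_apply,
    Module.End.one_apply, ← add_smul]
  congr 1
  push_cast
  ring

/-- The symmetric operator cᵢaᵢ has different eigenvalues on the two states when mᵢ ≠ m'ᵢ. The
Hamiltonian would not do, since distinct states may have equal energy. -/
theorem inner_state_eq_zero (hh : 0 < h) (hw : ∀ i, 0 < w i)
    (hG : ∀ i, P.annihilation h w i G = 0) {m m' : ι → ℕ} (hm : m ≠ m') :
    inner ℂ (P.j (P.state h w G m)) (P.j (P.state h w G m')) = 0 := by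
  obtain ⟨i, hi⟩ := Function.ne_iff.1 hm
  have h1 : inner ℂ (P.j (P.creation h w i (P.annihilation h w i (P.state h w G m))))
      (P.j (P.state h w G m')) = inner ℂ (P.j (P.state h w G m))
      (P.j (P.creation h w i (P.annihilation h w i (P.state h w G m')))) := by
    rw [inner_creation_left, inner_annihilation_left]
  rw [P.number_state hG, P.number_state hG, map_smul, map_smul, inner_smul_left, inner_smul_right,
    Complex.conj_ofReal, ← sub_eq_zero, ← sub_mul] at h1
  refine (mul_eq_zero.1 h1).resolve_left ?_
  rw [← Complex.ofReal_sub, Complex.ofReal_eq_zero, ← mul_sub]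
  have := hw i
  have h2 : (m i : ℝ) - m' i ≠ 0 := sub_ne_zero.2 (by exact_mod_cast hi)
  positivity

/-- By adjointness and the commutation relation, ‖cᵢψ‖² = ⟨ψ, aᵢcᵢψ⟩ = 2hwᵢ(mᵢ + 1)‖ψ‖², so creation
never annihilates a state. -/
theorem state_ne_zero (hh : 0 < h) (hw : ∀ i, 0 < w i)
    (hG : ∀ i, P.annihilation h w i G = 0) (hG0 : G ≠ 0) (m : ι → ℕ) : P.state h w G m ≠ 0 := by
  induction m using Pi.nat_induction with
  | h0 => rwa [state_zero]
  | h1 m i ih =>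
    rw [state_add_single]
    intro h0
    have h1 := P.inner_creation_left h w i (P.state h w G m) (P.creation h w i (P.state h w G m))
    have h2 := congrArg (fun A : Module.End ℂ S => A (P.state h w G m))
      (P.annihilation_mul_creation h w i i)
    simp only [Module.End.mul_apply, LinearMap.add_apply, if_true, LinearMap.smul_apply,
      Module.End.one_apply] at h2
    rw [h2, P.number_state hG, h0, map_zero, inner_zero_left, ← add_smul, map_smul,
      inner_smul_right] at h1
    rcases mul_eq_zero.1 h1.symm with h3 | h3
    · rw [← Complex.ofReal_add, Complex.ofReal_eq_zero] at h3
      have := hw i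
      exact absurd h3 (by positivity)
    · exact ih (P.j_injective (by rw [map_zero]; exact inner_self_eq_zero.1 h3))

theorem creation_mem_span (i : ι) {u : S} (hu : u ∈ Submodule.span ℂ (Set.range (P.state h w G))) :
    P.creation h w i u ∈ Submodule.span ℂ (Set.range (P.state h w G)) := by
  refine Submodule.span_le (p := (Submodule.span ℂ _).comap (P.creation h w i)) |>.2 ?_ hu
  rintro _ ⟨m, rfl⟩
  exact Submodule.subset_span ⟨_, P.state_add_single h w G m i⟩

theorem annihilation_mem_span (hG : ∀ i, P.annihilation h w i G = 0) (i : ι) {u : S}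
    (hu : u ∈ Submodule.span ℂ (Set.range (P.state h w G))) :
    P.annihilation h w i u ∈ Submodule.span ℂ (Set.range (P.state h w G)) := by
  refine Submodule.span_le (p := (Submodule.span ℂ _).comap (P.annihilation h w i)) |>.2 ?_ hu
  rintro _ ⟨m, rfl⟩
  change P.annihilation h w i _ ∈ Submodule.span ℂ (Set.range (P.state h w G))
  induction m using Pi.nat_induction with
  | h0 =>
    rw [state_zero, hG]
    exact Submodule.zero_mem _
  | h1 m k ih =>
    have h2 := congrArg (fun A : Module.End ℂ S => A (P.state h w G m))
      (P.annihilation_mul_creation h w i k)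
    simp only [Module.End.mul_apply, LinearMap.add_apply] at h2
    rw [state_add_single, h2]
    refine Submodule.add_mem _ (P.creation_mem_span k ih) ?_
    split_ifs
    · exact Submodule.smul_mem _ _ (Submodule.subset_span ⟨m, rfl⟩)
    · exact Submodule.zero_mem _

/-- The span of the states is invariant under the position operators. -/
theorem X_mem_span (hw : ∀ i, 0 < w i) (hG : ∀ i, P.annihilation h w i G = 0) (i : ι) {u : S}
    (hu : u ∈ Submodule.span ℂ (Set.range (P.state h w G))) :
    P.X i u ∈ Submodule.span ℂ (Set.range (P.state h w G)) := by
  have h0 : (w i : ℂ) ≠ 0 := Complex.ofReal_ne_zero.2 (hw i).ne'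
  have h1 : P.X i u = (2 * w i : ℂ)⁻¹ • (P.creation h w i u + P.annihilation h w i u) := by
    rw [eq_inv_smul_iff₀ (by simp [h0])]
    simp only [creation, annihilation, LinearMap.sub_apply, LinearMap.add_apply,
      LinearMap.smul_apply]
    module
  rw [h1]
  exact Submodule.smul_mem _ _
    (Submodule.add_mem _ (P.creation_mem_span i hu) (P.annihilation_mem_span hG i hu))

/-- The normalised states are kept as elements `v m` of `S`, where the Hamiltonian is defined;
completeness is an analytic input supplied separately. -/
theorem exists_hilbertBasis [CompleteSpace H] (hh : 0 < h) (hw : ∀ i, 0 < w i)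
    (hG : ∀ i, P.annihilation h w i G = 0) (hG0 : G ≠ 0)
    (hcomplete : ∀ f, (∀ m, inner ℂ (P.j (P.state h w G m)) f = 0) → f = 0) :
    ∃ (β : HilbertBasis (ι → ℕ) ℂ H) (v : (ι → ℕ) → S), (∀ m, β m = P.j (v m)) ∧
      ∀ m, P.hamiltonian h w (v m) = ((∑ i, (2 * (m i : ℝ) + 1) * h * w i : ℝ) : ℂ) • v m := by
  have hne : ∀ m, ‖P.j (P.state h w G m)‖ ≠ 0 := fun m => by
    rw [norm_ne_zero_iff, Ne, ← map_zero P.j, P.j_injective.eq_iff]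
    exact P.state_ne_zero hh hw hG hG0 m
  let v : (ι → ℕ) → S := fun m => ((‖P.j (P.state h w G m)‖⁻¹ : ℝ) : ℂ) • P.state h w G m
  have hon : Orthonormal ℂ fun m => P.j (v m) := by
    refine ⟨fun m => ?_, fun m m' hm => ?_⟩
    · change ‖P.j (v m)‖ = 1
      rw [map_smul, norm_smul, Complex.norm_real, norm_inv, norm_norm]
      exact inv_mul_cancel₀ (hne m)
    · change inner ℂ (P.j (v m)) (P.j (v m')) = 0
      rw [map_smul, map_smul, inner_smul_left, inner_smul_right,
        P.inner_state_eq_zero hh hw hG hm, mul_zero, mul_zero]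
  refine ⟨HilbertBasis.mkOfOrthogonalEqBot hon ?_, v, fun m => ?_, fun m => ?_⟩
  · refine (Submodule.eq_bot_iff _).2 fun f hf => hcomplete f fun m => ?_
    have h1 := (Submodule.mem_orthogonal _ _).1 hf _ (Submodule.subset_span ⟨m, rfl⟩)
    change inner ℂ (P.j (v m)) f = 0 at h1
    rw [map_smul, inner_smul_left] at h1
    refine (mul_eq_zero.1 h1).resolve_left ?_
    simpa using hne m
  · rw [HilbertBasis.coe_mkOfOrthogonalEqBot]
  · rw [map_smul, P.hamiltonian_state hG, smul_comm]

end States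

section Graph

variable [Fintype ι] {h w}

/-- An operator `T` that contains the closure of the Hamiltonian and that is contained in its
adjoint is diagonal in every Hilbert basis of eigenvectors, and it is equal to the adjoint. -/
theorem isDiagonal_of_core {κ : Type*} [Countable κ] {T : H →ₗ.[ℂ] H} {β : HilbertBasis κ ℂ H}
    {v : κ → S} {E : κ → ℝ} (hβ : ∀ m, β m = P.j (v m))
    (hv : ∀ m, P.hamiltonian h w (v m) = (E m : ℂ) • v m)
    (hweak : ∀ u f, (u, f) ∈ T.graph →
      ∀ φ, inner ℂ (P.j φ) f = inner ℂ (P.j (P.hamiltonian h w φ)) u)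
    (hclosed : ∀ (s : ℕ → S) (u f : H), Filter.Tendsto (fun k => P.j (s k)) Filter.atTop (nhds u) →
      Filter.Tendsto (fun k => P.j (P.hamiltonian h w (s k))) Filter.atTop (nhds f) →
      (u, f) ∈ T.graph) :
    T.IsDiagonal β E ∧ ∀ u f, (u, f) ∈ T.graph ↔
      ∀ φ, inner ℂ (P.j φ) f = inner ℂ (P.j (P.hamiltonian h w φ)) u := by
  have h1 : ∀ u f, (∀ φ, inner ℂ (P.j φ) f = inner ℂ (P.j (P.hamiltonian h w φ)) u) →
      ∀ m, inner ℂ (β m) f = E m * inner ℂ (β m) u := fun u f huf m => by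
    rw [hβ, huf, hv, map_smul, inner_smul_left, Complex.conj_ofReal]
  have h2 : ∀ u f, (∀ m, inner ℂ (β m) f = E m * inner ℂ (β m) u) → (u, f) ∈ T.graph := by
    intro u f huf
    -- Countability of `κ` allows partial sums along a sequence of finite sets. Those of `u` lie in
    -- `S`, and the Hamiltonian sends them to those of `f`.
    obtain ⟨s, hs⟩ := Filter.exists_seq_tendsto (Filter.atTop : Filter (Finset κ))
    refine hclosed (fun k => ∑ m ∈ s k, inner ℂ (β m) u • v m) u f ?_ ?_
    · have h3 := (β.hasSum_repr u).comp hs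
      simpa [Function.comp_def, β.repr_apply_apply, hβ] using h3
    · have h3 := (β.hasSum_repr f).comp hs
      refine h3.congr fun k => ?_
      simp only [Function.comp_apply, β.repr_apply_apply, map_sum, map_smul, hv, huf]
      refine Finset.sum_congr rfl fun m _ => ?_
      rw [← hβ, smul_smul, mul_comm]
  exact ⟨fun u f => ⟨fun huf => h1 u f (hweak u f huf), h2 u f⟩,
    fun u f => ⟨hweak u f, fun huf => h2 u f (h1 u f huf)⟩⟩

end Graph

end CanonicalPair

/-- All terms are positive, so each single mᵢhwᵢ is at most `r`, and `m` lies in a finite box. -/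
theorem finite_setOf_abs_sum_le {ι : Type*} [Fintype ι] [DecidableEq ι] {h : ℝ} {w : ι → ℝ}
    (hh : 0 < h) (hw : ∀ i, 0 < w i) (r : ℝ) :
    {m : ι → ℕ | |∑ i, (2 * (m i : ℝ) + 1) * h * w i| ≤ r}.Finite := by
  refine (Set.finite_Iic fun i => ⌊r / (h * w i)⌋₊).subset fun m hm i => ?_
  have hi := hw i
  refine Nat.le_floor ((le_div_iff₀ (by positivity)).2 ?_)
  refine le_trans ?_ ((le_abs_self _).trans hm)
  refine le_trans ?_ (Finset.single_le_sum (f := fun i => (2 * (m i : ℝ) + 1) * h * w i)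
    (fun k _ => by have := hw k; positivity) (Finset.mem_univ i))
  have : 0 ≤ (m i : ℝ) * (h * w i) := by positivity
  have : 0 < h * w i := by positivity
  nlinarith

end

/-! ### Realization on Schwartz functions and the Gaussian ground state. -/

section

open MeasureTheory
open scoped SchwartzMap ContDiff LineDeriv

/-- Use tᴺ ≤ N! eᵗ at t = 1 + r, then complete the square in r - cr² ≤ 1/(4c). -/
theorem Real.one_add_pow_mul_exp_neg_le {c r : ℝ} (hc : 0 < c) (hr : 0 ≤ r) (N : ℕ) :
    (1 + r) ^ N * Real.exp (-(c * r ^ 2)) ≤ N.factorial * Real.exp (1 + 1 / (4 * c)) := by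
  have h1 := Real.pow_div_factorial_le_exp (1 + r) (by positivity) N
  rw [div_le_iff₀' (by positivity)] at h1
  have h2 : 1 + r - c * r ^ 2 ≤ 1 + 1 / (4 * c) := by
    have : 1 / (4 * c) - r + c * r ^ 2 = c * (r - 1 / (2 * c)) ^ 2 := by
      field_simp
      ring
    nlinarith [mul_nonneg hc.le (sq_nonneg (r - 1 / (2 * c)))]
  calc (1 + r) ^ N * Real.exp (-(c * r ^ 2))
      ≤ (N.factorial * Real.exp (1 + r)) * Real.exp (-(c * r ^ 2)) := by gcongr
    _ = N.factorial * Real.exp (1 + r - c * r ^ 2) := by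
      rw [mul_assoc, ← Real.exp_add, sub_eq_add_neg]
    _ ≤ _ := by gcongr

/-- `exp (-q)` is a Schwartz function if `q` has temperate growth and grows quadratically. -/
theorem Function.HasTemperateGrowth.exists_schwartzMap_exp_neg {E : Type*} [NormedAddCommGroup E]
    [NormedSpace ℝ E] {q : E → ℝ} (hq : q.HasTemperateGrowth) {c : ℝ} (hc : 0 < c)
    (hqc : ∀ x, c * ‖x‖ ^ 2 ≤ q x) : ∃ G : 𝓢(E, ℝ), ∀ x, G x = Real.exp (-q x) := by
  refine ⟨⟨fun x => Real.exp (-q x), by have := hq.1; fun_prop, fun k n => ?_⟩, fun _ => rfl⟩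
  have hq' : (fun x => -q x).HasTemperateGrowth := hq.neg
  obtain ⟨l, C, hC, hl⟩ := hq'.norm_iteratedFDeriv_le_uniform n
  refine ⟨n.factorial * (C + 1) ^ n *
    ((k + l * n).factorial * Real.exp (1 + 1 / (4 * c))), fun x => ?_⟩
  -- Faà di Bruno bound: every derivative of exp at -q is exp(-q). Taking `C + 1` instead of `C`
  -- makes the base at least 1, so its i-th power dominates it.
  have h1 : ‖iteratedFDeriv ℝ n (Real.exp ∘ fun x => -q x) x‖ ≤
      n.factorial * Real.exp (-q x) * ((C + 1) * (1 + ‖x‖) ^ l) ^ n := by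
    refine norm_iteratedFDeriv_comp_le (N := ∞) Real.contDiff_exp hq'.1 (mod_cast le_top) x
      (fun i _ => ?_) fun i hi hin => (hl i hin x).trans ?_
    · rw [norm_iteratedFDeriv_eq_norm_iteratedDeriv, iteratedDeriv_eq_iterate,
        Real.iter_deriv_exp, Real.norm_eq_abs, Real.abs_exp]
    · rw [mul_pow]
      have hi' : i ≠ 0 := by omega
      gcongr
      · exact le_trans (by simp) (le_self_pow₀ (by simp [hC]) hi')
      · exact le_self_pow₀ (one_le_pow₀ (by simp)) hi'
  have h2 : Real.exp (-q x) ≤ Real.exp (-(c * ‖x‖ ^ 2)) :=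
    Real.exp_le_exp.2 (neg_le_neg (hqc x))
  have h3 : ‖x‖ ^ k ≤ (1 + ‖x‖) ^ k := by gcongr; simp
  calc ‖x‖ ^ k * ‖iteratedFDeriv ℝ n (Real.exp ∘ fun x => -q x) x‖
      ≤ (1 + ‖x‖) ^ k *
        (n.factorial * Real.exp (-(c * ‖x‖ ^ 2)) * ((C + 1) * (1 + ‖x‖) ^ l) ^ n) := by
        refine mul_le_mul h3 (h1.trans ?_) (norm_nonneg _) (by positivity)
        gcongr
    _ = n.factorial * (C + 1) ^ n *
        ((1 + ‖x‖) ^ (k + l * n) * Real.exp (-(c * ‖x‖ ^ 2))) := by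
        rw [mul_pow, pow_add, ← pow_mul]
        ring
    _ ≤ _ := mul_le_mul_of_nonneg_left (Real.one_add_pow_mul_exp_neg_le hc (norm_nonneg x) _)
        (by positivity)

namespace HarmonicOscillator

variable {n : ℕ}

theorem ofReal_inner_hasTemperateGrowth (v : EuclideanSpace ℝ (Fin n)) :
    (fun x : EuclideanSpace ℝ (Fin n) => ((inner ℝ v x : ℝ) : ℂ)).HasTemperateGrowth := by
  fun_prop

/-- Multiplication of Schwartz functions by the linear form `⟨v, x⟩`. -/
def position (v : EuclideanSpace ℝ (Fin n)) : Module.End ℂ 𝓢(EuclideanSpace ℝ (Fin n), ℂ) :=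
  (SchwartzMap.smulLeftCLM ℂ
    (fun x : EuclideanSpace ℝ (Fin n) => ((inner ℝ v x : ℝ) : ℂ))).toLinearMap

/-- The directional derivative of Schwartz functions. -/
def directional (v : EuclideanSpace ℝ (Fin n)) : Module.End ℂ 𝓢(EuclideanSpace ℝ (Fin n), ℂ) :=
  (LineDeriv.lineDerivOpCLM ℂ 𝓢(EuclideanSpace ℝ (Fin n), ℂ) v).toLinearMap

theorem position_apply (v : EuclideanSpace ℝ (Fin n)) (u : 𝓢(EuclideanSpace ℝ (Fin n), ℂ))
    (x : EuclideanSpace ℝ (Fin n)) : position v u x = ((inner ℝ v x : ℝ) : ℂ) * u x :=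
  SchwartzMap.smulLeftCLM_apply_apply (ofReal_inner_hasTemperateGrowth v) u x

theorem directional_apply (v : EuclideanSpace ℝ (Fin n)) (u : 𝓢(EuclideanSpace ℝ (Fin n), ℂ))
    (x : EuclideanSpace ℝ (Fin n)) : directional v u x = fderiv ℝ u x v := rfl

/-- The inclusion of the Schwartz functions into `L²`. -/
def schwartzToL2 : 𝓢(EuclideanSpace ℝ (Fin n), ℂ) →ₗ[ℂ] L2 n :=
  (SchwartzMap.toLpCLM ℂ ℂ 2 volume).toLinearMap

theorem schwartzToL2_ae (u : 𝓢(EuclideanSpace ℝ (Fin n), ℂ)) : schwartzToL2 u =ᵐ[volume] u :=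
  SchwartzMap.coeFn_toLp u 2 volume

theorem inner_schwartzToL2 (u v : 𝓢(EuclideanSpace ℝ (Fin n), ℂ)) :
    inner ℂ (schwartzToL2 u) (schwartzToL2 v) = ∫ x, v x * (starRingEnd ℂ) (u x) :=
  SchwartzMap.inner_toL2_toL2_eq u v volume

/-- Complex conjugation of Schwartz functions. -/
def conjugate (u : 𝓢(EuclideanSpace ℝ (Fin n), ℂ)) : 𝓢(EuclideanSpace ℝ (Fin n), ℂ) :=
  SchwartzMap.postcompCLM (𝕜 := ℝ) (Complex.conjCLE : ℂ →L[ℝ] ℂ) u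

theorem conjugate_apply (u : 𝓢(EuclideanSpace ℝ (Fin n), ℂ)) (x : EuclideanSpace ℝ (Fin n)) :
    conjugate u x = (starRingEnd ℂ) (u x) := rfl

/-- Integration by parts is bilinear while the inner product conjugates its first argument;
conjugation of Schwartz functions passes between the two. -/
theorem conjugate_directional (v : EuclideanSpace ℝ (Fin n))
    (u : 𝓢(EuclideanSpace ℝ (Fin n), ℂ)) :
    conjugate (directional v u) = directional v (conjugate u) := by
  ext x
  have h1 := ((Complex.conjCLE : ℂ →L[ℝ] ℂ).hasFDerivAt.comp x (u.hasFDerivAt x)).fderiv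
  have h2 : ((Complex.conjCLE : ℂ →L[ℝ] ℂ) : ℂ → ℂ) ∘ u = conjugate u := rfl
  rw [h2] at h1
  rw [conjugate_apply, directional_apply, directional_apply, h1]
  rfl

theorem directional_position (v v' : EuclideanSpace ℝ (Fin n))
    (u : 𝓢(EuclideanSpace ℝ (Fin n), ℂ)) :
    directional v (position v' u) = position v' (directional v u) +
      ((inner ℝ v' v : ℝ) : ℂ) • u := by
  ext x
  have h1 : HasFDerivAt (fun x : EuclideanSpace ℝ (Fin n) => ((inner ℝ v' x : ℝ) : ℂ))
      (Complex.ofRealCLM ∘L innerSL ℝ v') x :=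
    (Complex.ofRealCLM ∘L innerSL ℝ v').hasFDerivAt
  have h2 := (h1.mul (u.hasFDerivAt x)).fderiv
  have h3 : (fun x => ((inner ℝ v' x : ℝ) : ℂ)) * (u : EuclideanSpace ℝ (Fin n) → ℂ) =
      position v' u := funext fun x => (position_apply v' u x).symm
  rw [h3] at h2
  change directional v (position v' u) x = position v' (directional v u) x +
    ((inner ℝ v' v : ℝ) : ℂ) * u x
  rw [directional_apply, h2, position_apply, directional_apply]
  simp
  ring

/-- The position and derivative operators in an orthonormal basis. -/
def canonicalPair (b : OrthonormalBasis (Fin n) ℝ (EuclideanSpace ℝ (Fin n))) :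
    CanonicalPair (Fin n) 𝓢(EuclideanSpace ℝ (Fin n), ℂ) (L2 n) where
  X i := position (b i)
  D i := directional (b i)
  j := schwartzToL2
  j_injective := SchwartzMap.injective_toLp 2 volume
  X_comm i k := by
    ext u x
    simp only [Module.End.mul_apply, position_apply]
    ring
  D_comm i k := by
    ext u x
    simp only [Module.End.mul_apply, directional_apply]
    have h1 : ∀ v v' : EuclideanSpace ℝ (Fin n),
        fderiv ℝ (directional v u) x v' = fderiv ℝ (fderiv ℝ u) x v' v := fun v v' => by
      have h2 : (directional v u : EuclideanSpace ℝ (Fin n) → ℂ) = fun y => fderiv ℝ u y v := rfl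
      have h3 : DifferentiableAt ℝ (fderiv ℝ u) x :=
        (SchwartzMap.fderivCLM ℝ _ ℂ u).differentiableAt
      rw [h2, fderiv_clm_apply h3 (differentiableAt_const v)]
      simp
    rw [h1, h1]
    exact ((u.smooth 2).contDiffAt.isSymmSndFDerivAt (by simp)).eq _ _
  D_X i k := by
    ext1 u
    rw [Module.End.mul_apply, directional_position]
    rcases eq_or_ne i k with rfl | hik
    · simp
    · simp [hik, b.inner_eq_zero hik.symm]
  X_symm i u v := by
    rw [inner_schwartzToL2, inner_schwartzToL2]
    congr 1
    ext x
    simp only [position_apply, map_mul, Complex.conj_ofReal]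
    ring
  D_skew i u v := by
    rw [inner_schwartzToL2, inner_schwartzToL2]
    simp only [← conjugate_apply, conjugate_directional]
    exact SchwartzMap.integral_mul_lineDerivOp_right_eq_neg_left v (conjugate u) (b i)

section

variable (b : OrthonormalBasis (Fin n) ℝ (EuclideanSpace ℝ (Fin n))) {h : ℝ} {w : Fin n → ℝ}

/-- The quadratic form with eigenvalues `wᵢ` in the orthonormal basis `b`. -/
def diagonalForm (w : Fin n → ℝ) (x : EuclideanSpace ℝ (Fin n)) : ℝ :=
  ∑ i, w i * inner ℝ (b i) x ^ 2

theorem diagonalForm_hasTemperateGrowth : (diagonalForm b w).HasTemperateGrowth := by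
  unfold diagonalForm
  fun_prop

theorem exists_le_diagonalForm (hw : ∀ i, 0 < w i) :
    ∃ c > 0, ∀ x, c * ‖x‖ ^ 2 ≤ diagonalForm b w x := by
  obtain ⟨c, hc, hcw⟩ : ∃ c > 0, ∀ i, c ≤ w i := by
    by_cases hne : (Finset.univ : Finset (Fin n)).Nonempty
    · obtain ⟨i, -, hi⟩ := Finset.exists_min_image _ w hne
      exact ⟨w i, hw i, fun k => hi k (Finset.mem_univ k)⟩
    -- In dimension 0 there is no minimum and any positive constant serves.
    · exact ⟨1, one_pos, fun i => absurd ⟨i, Finset.mem_univ i⟩ hne⟩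
  refine ⟨c, hc, fun x => ?_⟩
  rw [← b.sum_sq_norm_inner_right x, diagonalForm, Finset.mul_sum]
  refine Finset.sum_le_sum fun i _ => ?_
  rw [Real.norm_eq_abs, sq_abs]
  gcongr
  exact hcw i

/-- The Gaussian ground state. -/
theorem exists_groundState (hh : 0 < h) (hw : ∀ i, 0 < w i) :
    ∃ G : 𝓢(EuclideanSpace ℝ (Fin n), ℂ),
      (∀ x, G x = (Real.exp (-(diagonalForm b w x / (2 * h))) : ℂ)) ∧
      ∀ i, (canonicalPair b).annihilation h w i G = 0 := by
  obtain ⟨c, hc, hcw⟩ := exists_le_diagonalForm b hw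
  have hq : (fun x => diagonalForm b w x / (2 * h)).HasTemperateGrowth := by
    have := diagonalForm_hasTemperateGrowth b (w := w)
    simp only [div_eq_mul_inv]
    fun_prop
  obtain ⟨G, hG⟩ := hq.exists_schwartzMap_exp_neg (c := c / (2 * h)) (by positivity) fun x => by
    rw [div_mul_eq_mul_div]
    gcongr
    exact hcw x
  refine ⟨SchwartzMap.postcompCLM (𝕜 := ℝ) Complex.ofRealCLM G, fun x => ?_, fun i => ?_⟩
  · rw [SchwartzMap.postcompCLM_apply, hG]
    simp
  · ext x
    have h1 : HasFDerivAt (fun x => Real.exp (-(diagonalForm b w x / (2 * h))))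
        (Real.exp (-(diagonalForm b w x / (2 * h))) •
          -((2 * h)⁻¹ • ∑ k, w k • ((2 * inner ℝ (b k) x) • innerSL ℝ (b k)))) x := by
      refine HasFDerivAt.exp (HasFDerivAt.neg ?_)
      simp only [div_eq_inv_mul]
      refine HasFDerivAt.const_mul (HasFDerivAt.fun_sum fun k _ => HasFDerivAt.const_mul ?_ _) _
      have := ((innerSL ℝ (b k)).hasFDerivAt (x := x)).pow 2
      simpa using this
    have h2 := (Complex.ofRealCLM.hasFDerivAt.comp x h1).fderiv
    have h3 : (Complex.ofRealCLM : ℝ → ℂ) ∘ (fun x => Real.exp (-(diagonalForm b w x / (2 * h)))) =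
        SchwartzMap.postcompCLM (𝕜 := ℝ) Complex.ofRealCLM G := by
      ext y
      rw [SchwartzMap.postcompCLM_apply, hG]
      rfl
    rw [h3] at h2
    -- ∂ᵢ exp(-∑ wₖxₖ²/(2h)) = -(wᵢxᵢ/h) exp(-∑ wₖxₖ²/(2h)). The exponent carries wₖ, whereas the
    -- potential carries wₖ².
    change (w i : ℂ) * position (b i) _ x + (h : ℂ) * directional (b i) _ x = 0
    rw [directional_apply, h2, position_apply, SchwartzMap.postcompCLM_apply, hG]
    have h4 : ∀ k, w k * (2 * inner ℝ (b k) x * inner ℝ (b k) (b i)) =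
        if k = i then w i * (2 * inner ℝ (b i) x) else 0 := fun k => by
      rcases eq_or_ne k i with rfl | hk
      · simp
      · simp [hk, b.inner_eq_zero hk]
    have hh0 : (h : ℂ) ≠ 0 := by exact_mod_cast hh.ne'
    simp [h4]
    field_simp
    ring

end

end HarmonicOscillator

end

/-! ### Completeness of the states through moments and the Fourier transform. -/

section

open MeasureTheory
open scoped SchwartzMap FourierTransform

section Moments

variable {V : Type*} [NormedAddCommGroup V] [InnerProductSpace ℝ V] [FiniteDimensional ℝ V]
  [MeasurableSpace V] [BorelSpace V]

/-- An integrable function is determined by its Fourier transform. -/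
theorem MeasureTheory.Integrable.ae_eq_zero_of_fourier_eq_zero {F : V → ℂ} (hF : Integrable F)
    (h : ∀ ξ, 𝓕 F ξ = 0) : F =ᵐ[volume] 0 := by
  have hL : MemLp F 1 volume := memLp_one_iff_integrable.2 hF
  have h0 : hL.toLp F = 0 := by
    refine LinearMap.ker_eq_bot'.1 (Lp.ker_toTemperedDistributionCLM_eq_bot (F := ℂ) (p := 1)
      (μ := (volume : Measure V))) _ ?_
    ext φ
    -- Writing φ as the transform of 𝓕⁻φ and moving the transform onto `F` turns ∫ φF into ∫
    -- (𝓕⁻φ)(𝓕F) = 0.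
    have h1 := VectorFourier.integral_fourierIntegral_smul_eq_flip (L := innerₗ V)
      Real.continuous_fourierChar continuous_inner ((𝓕⁻ φ).integrable (μ := volume)) hF
    have h2 : ∀ x, VectorFourier.fourierIntegral Real.fourierChar volume (innerₗ V)
        (𝓕⁻ φ : 𝓢(V, ℂ)) x =
        φ x := fun x => by
      have h3 : (𝓕 (𝓕⁻ φ : 𝓢(V, ℂ)) : 𝓢(V, ℂ)) x = φ x := by
        rw [FourierTransform.fourier_fourierInv_eq]
      rw [← h3, SchwartzMap.fourier_coe]
      rfl
    have h4 : ∀ x, VectorFourier.fourierIntegral Real.fourierChar volume (innerₗ V).flip F x =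
        0 := fun x => by
      rw [flip_innerₗ]
      exact h x
    simp only [h2, h4, smul_zero, integral_zero] at h1
    change Lp.toTemperedDistribution (hL.toLp F) φ = 0
    rw [Lp.toTemperedDistribution_apply, ← h1]
    refine integral_congr_ae ?_
    filter_upwards [hL.coeFn_toLp] with x hx
    rw [hx]
  exact (hL.toLp_eq_toLp_iff MemLp.zero).1 (h0.trans (MemLp.toLp_zero _).symm)

/-- A function with exponential moments is determined by its moments. -/
theorem MeasureTheory.ae_eq_zero_of_moments_eq_zero {F : V → ℂ}
    (hF : AEStronglyMeasurable F volume)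
    (hexp : ∀ ξ : V, Integrable fun x => Real.exp |inner ℝ ξ x| * ‖F x‖)
    (hmom : ∀ (ξ : V) (k : ℕ), ∫ x, ((inner ℝ ξ x : ℝ) : ℂ) ^ k * F x = 0) : F =ᵐ[volume] 0 := by
  have hint : Integrable F := by
    have h1 := hexp 0
    simp only [inner_zero_left, abs_zero, Real.exp_zero, one_mul] at h1
    exact (integrable_norm_iff hF).1 h1
  refine hint.ae_eq_zero_of_fourier_eq_zero fun ξ => ?_
  rw [Real.fourier_eq']
  set η : V := (-2 * Real.pi) • ξ with hη
  have hbound : ∀ x, HasSum (fun k : ℕ => |inner ℝ η x| ^ k / k.factorial * ‖F x‖)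
      (Real.exp |inner ℝ η x| * ‖F x‖) := fun x => by
    rw [Real.exp_eq_exp_ℝ]
    exact (NormedSpace.expSeries_div_hasSum_exp |inner ℝ η x|).mul_right _
  -- With η = -2πξ the Fourier integral is ∫ exp(i⟨η, x⟩)F. Its power series may be integrated term
  -- by term, the terms being dominated by the series of exp|⟨η, x⟩|·‖F‖; each term is a moment.
  have hsum := hasSum_integral_of_dominated_convergence (μ := (volume : Measure V))
    (F := fun (k : ℕ) (x : V) =>
      (((inner ℝ η x : ℝ) : ℂ) * Complex.I) ^ k / (k.factorial : ℂ) * F x)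
    (f := fun x => Complex.exp (((inner ℝ η x : ℝ) : ℂ) * Complex.I) * F x)
    (fun k x => |inner ℝ η x| ^ k / k.factorial * ‖F x‖)
    (fun k => (by fun_prop : Continuous fun x : V =>
      (((inner ℝ η x : ℝ) : ℂ) * Complex.I) ^ k / (k.factorial : ℂ)).aestronglyMeasurable.mul hF)
    (fun k => ae_of_all _ fun x => by simp)
    (ae_of_all _ fun x => (hbound x).summable)
    (by simpa only [(hbound _).tsum_eq] using hexp η)
    (ae_of_all _ fun x => by
      rw [Complex.exp_eq_exp_ℂ]
      exact (NormedSpace.expSeries_div_hasSum_exp (((inner ℝ η x : ℝ) : ℂ) * Complex.I)).mul_right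
        (F x))
  have h2 : ∀ k : ℕ, ∫ x, (((inner ℝ η x : ℝ) : ℂ) * Complex.I) ^ k / (k.factorial : ℂ) * F x =
      0 := fun k => by
    have h3 := hmom η k
    have h4 : (fun x => (((inner ℝ η x : ℝ) : ℂ) * Complex.I) ^ k / (k.factorial : ℂ) * F x) =
        fun x => (Complex.I ^ k / (k.factorial : ℂ)) * (((inner ℝ η x : ℝ) : ℂ) ^ k * F x) := by
      ext x
      ring
    rw [h4, integral_const_mul, h3, mul_zero]
  simp only [h2] at hsum
  rw [← hsum.unique hasSum_zero]
  refine integral_congr_ae (ae_of_all _ fun x => ?_)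
  simp only [hη, inner_smul_left, smul_eq_mul, real_inner_comm]
  simp

end Moments

namespace HarmonicOscillator

variable {n : ℕ} (b : OrthonormalBasis (Fin n) ℝ (EuclideanSpace ℝ (Fin n))) {h : ℝ}
  {w : Fin n → ℝ}

theorem position_eq_sum (ξ : EuclideanSpace ℝ (Fin n)) (u : 𝓢(EuclideanSpace ℝ (Fin n), ℂ)) :
    position ξ u = ∑ i, ((inner ℝ (b i) ξ : ℝ) : ℂ) • position (b i) u := by
  ext x
  rw [sum_apply, position_apply, ← b.sum_inner_mul_inner ξ x, Complex.ofReal_sum,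
    Finset.sum_mul]
  refine Finset.sum_congr rfl fun i _ => ?_
  change _ = ((inner ℝ (b i) ξ : ℝ) : ℂ) * position (b i) u x
  rw [position_apply, Complex.ofReal_mul, real_inner_comm, mul_assoc]

/-- Half of the Gaussian exponent absorbs the linear exponential, by completing the square; the
other half remains for integrability. -/
theorem exp_abs_inner_mul_exp_neg_le {c : ℝ} (hc : 0 < c) {V : Type*} [NormedAddCommGroup V]
    [InnerProductSpace ℝ V] (ξ x : V) :
    Real.exp |inner ℝ ξ x| * Real.exp (-(c * ‖x‖ ^ 2)) ≤
      Real.exp (‖ξ‖ ^ 2 / (2 * c)) * Real.exp (-(c / 2 * ‖x‖ ^ 2)) := by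
  rw [← Real.exp_add, ← Real.exp_add]
  refine Real.exp_le_exp.2 ?_
  have h1 := abs_real_inner_le_norm ξ x
  have h2 : ‖ξ‖ ^ 2 / (2 * c) - ‖ξ‖ * ‖x‖ + c / 2 * ‖x‖ ^ 2 =
      (‖ξ‖ - c * ‖x‖) ^ 2 / (2 * c) := by
    field_simp
    ring
  have h3 : 0 ≤ (‖ξ‖ - c * ‖x‖) ^ 2 / (2 * c) := by positivity
  linarith

/-- The states of the harmonic oscillator are complete. -/
theorem eq_zero_of_inner_state_eq_zero (hh : 0 < h) (hw : ∀ i, 0 < w i)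
    {G : 𝓢(EuclideanSpace ℝ (Fin n), ℂ)}
    (hG : ∀ x, G x = (Real.exp (-(diagonalForm b w x / (2 * h))) : ℂ))
    (hG' : ∀ i, (canonicalPair b).annihilation h w i G = 0) (f : L2 n)
    (hf : ∀ m, inner ℂ ((canonicalPair b).j ((canonicalPair b).state h w G m)) f = 0) : f = 0 := by
  set W := Submodule.span ℂ (Set.range ((canonicalPair b).state h w G))
  have hW : ∀ u ∈ W, inner ℂ (schwartzToL2 u) f = 0 := fun u hu => by
    induction hu using Submodule.span_induction with
    | mem u hu =>
      obtain ⟨m, rfl⟩ := hu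
      exact hf m
    | zero => simp
    | add u v _ _ hu hv => rw [map_add, inner_add_left, hu, hv, add_zero]
    | smul c u _ hu => rw [map_smul, inner_smul_left, hu, mul_zero]
  have hGW : G ∈ W := Submodule.subset_span ⟨0, CanonicalPair.state_zero _ _ _ _⟩
  have hpos : ∀ ξ, ∀ u ∈ W, position ξ u ∈ W := fun ξ u hu => by
    rw [position_eq_sum b]
    exact Submodule.sum_mem _ fun i _ => Submodule.smul_mem _ _
      ((canonicalPair b).X_mem_span hw hG' i hu)
  -- The span of the states is stable under multiplication by linear forms, so orthogonality to the
  -- states kills all moments of f·G.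
  have hpow : ∀ ξ (k : ℕ), ∃ u ∈ W, ∀ x, u x = ((inner ℝ ξ x : ℝ) : ℂ) ^ k * G x := fun ξ k => by
    induction k with
    | zero => exact ⟨G, hGW, fun x => by simp⟩
    | succ k ih =>
      obtain ⟨u, hu, hux⟩ := ih
      refine ⟨position ξ u, hpos ξ u hu, fun x => ?_⟩
      rw [position_apply, hux]
      ring
  have hGreal : ∀ x, (starRingEnd ℂ) (G x) = G x := fun x => by rw [hG, Complex.conj_ofReal]
  obtain ⟨c, hc, hcw⟩ := exists_le_diagonalForm b hw
  have hc' : 0 < c / (2 * h) := by positivity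
  have hGle : ∀ x, ‖G x‖ ≤ Real.exp (-(c / (2 * h) * ‖x‖ ^ 2)) := fun x => by
    rw [hG, Complex.norm_real, Real.norm_eq_abs, Real.abs_exp, div_mul_eq_mul_div]
    gcongr
    exact hcw x
  have hzero : (fun x => f x * G x) =ᵐ[volume] 0 := by
    refine ae_eq_zero_of_moments_eq_zero
      ((Lp.aestronglyMeasurable f).mul G.continuous.aestronglyMeasurable) (fun ξ => ?_)
      fun ξ k => ?_
    · obtain ⟨g, hg⟩ := Function.HasTemperateGrowth.exists_schwartzMap_exp_neg
        (E := EuclideanSpace ℝ (Fin n)) (q := fun x => c / (2 * h) / 2 * ‖x‖ ^ 2) (by fun_prop)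
        (c := c / (2 * h) / 2) (by positivity) fun x => le_rfl
      have h1 : Integrable (fun x => ‖f x‖ * g x) :=
        MemLp.integrable_mul (Lp.memLp f).norm (g.memLp 2 volume)
      refine (h1.const_mul (Real.exp (‖ξ‖ ^ 2 / (2 * (c / (2 * h)))))).mono' ?_
        (ae_of_all _ fun x => ?_)
      · exact (by fun_prop : Continuous fun x : EuclideanSpace ℝ (Fin n) =>
          Real.exp |inner ℝ ξ x|).aestronglyMeasurable.mul
          ((Lp.aestronglyMeasurable f).mul G.continuous.aestronglyMeasurable).norm
      · have h2 := exp_abs_inner_mul_exp_neg_le hc' ξ x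
        rw [Real.norm_of_nonneg (by positivity), norm_mul, hg]
        calc Real.exp |inner ℝ ξ x| * (‖f x‖ * ‖G x‖)
            ≤ Real.exp |inner ℝ ξ x| * (‖f x‖ * Real.exp (-(c / (2 * h) * ‖x‖ ^ 2))) := by
              gcongr
              exact hGle x
          _ = ‖f x‖ * (Real.exp |inner ℝ ξ x| * Real.exp (-(c / (2 * h) * ‖x‖ ^ 2))) := by ring
          _ ≤ ‖f x‖ * (Real.exp (‖ξ‖ ^ 2 / (2 * (c / (2 * h)))) *
              Real.exp (-(c / (2 * h) / 2 * ‖x‖ ^ 2))) := by gcongr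
          _ = _ := by ring
    · obtain ⟨u, hu, hux⟩ := hpow ξ k
      rw [← hW u hu]
      refine integral_congr_ae ?_
      filter_upwards [schwartzToL2_ae u] with x hx
      rw [hx, hux, RCLike.inner_apply, map_mul, map_pow, Complex.conj_ofReal, hGreal]
      ring
  rw [Lp.eq_zero_iff_ae_eq_zero]
  filter_upwards [hzero] with x hx
  refine (mul_eq_zero.1 hx).resolve_right ?_
  rw [hG]
  exact Complex.ofReal_ne_zero.2 (Real.exp_ne_zero _)

theorem exists_hilbertBasis (hh : 0 < h) (hw : ∀ i, 0 < w i) :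
    ∃ (β : HilbertBasis (Fin n → ℕ) ℂ (L2 n))
      (v : (Fin n → ℕ) → 𝓢(EuclideanSpace ℝ (Fin n), ℂ)),
      (∀ m, β m = (canonicalPair b).j (v m)) ∧ ∀ m, (canonicalPair b).hamiltonian h w (v m) =
        ((∑ i, (2 * (m i : ℝ) + 1) * h * w i : ℝ) : ℂ) • v m := by
  obtain ⟨G, hG, hG'⟩ := exists_groundState b hh hw
  refine (canonicalPair b).exists_hilbertBasis hh hw hG' (fun h0 => ?_)
    (eq_zero_of_inner_state_eq_zero b hh hw hG hG')
  have h1 := hG 0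
  rw [h0] at h1
  exact Complex.ofReal_ne_zero.2 (Real.exp_ne_zero _) h1.symm

end HarmonicOscillator

end

/-! ### The domain H² ∩ D(V): between closure and adjoint. -/

section

open MeasureTheory TemperedDistribution Filter Topology
open scoped SchwartzMap FourierTransform Laplacian

namespace CanonicalPair

variable {ι S H : Type*} [DecidableEq ι] [AddCommGroup S] [Module ℂ S]
  [NormedAddCommGroup H] [InnerProductSpace ℂ H] (P : CanonicalPair ι S H) (h : ℝ) (w : ι → ℝ)
  [Fintype ι]

theorem inner_kinetic_left (u v : S) :
    inner ℂ (P.j (P.kinetic h u)) (P.j v) = inner ℂ (P.j u) (P.j (P.kinetic h v)) := by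
  simp only [kinetic, LinearMap.neg_apply, LinearMap.sum_apply, LinearMap.smul_apply, map_neg,
    map_sum, map_smul, inner_neg_left, inner_neg_right, sum_inner, inner_sum, inner_smul_left,
    inner_smul_right, Module.End.mul_apply, Complex.conj_ofReal, P.D_skew, neg_neg]

/-- By `norm_potential_sq_le`, ‖Vu‖ ≤ ‖Hu‖ + √C‖u‖, so graph-norm convergence makes the potential
parts Cauchy on their own. -/
theorem exists_tendsto_potential [CompleteSpace H] {s : ℕ → S} {u f : H}
    (hu : Tendsto (fun k => P.j (s k)) atTop (𝓝 u))
    (hf : Tendsto (fun k => P.j (P.hamiltonian h w (s k))) atTop (𝓝 f)) :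
    ∃ g, Tendsto (fun k => P.j (P.potential w (s k))) atTop (𝓝 g) := by
  set C := 2 * ∑ k, ∑ _i : ι, h ^ 2 * w k ^ 2 with hC
  have hC0 : 0 ≤ C := by positivity
  refine cauchySeq_tendsto_of_complete (cauchySeq_iff_tendsto_dist_atTop_0.2 ?_)
  have hu' := cauchySeq_iff_tendsto_dist_atTop_0.1 hu.cauchySeq
  have hf' := cauchySeq_iff_tendsto_dist_atTop_0.1 hf.cauchySeq
  have hlim := hf'.add (hu'.const_mul (Real.sqrt C))
  rw [mul_zero, add_zero] at hlim
  refine squeeze_zero (fun _ => dist_nonneg) (fun p => ?_) hlim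
  rw [dist_eq_norm, dist_eq_norm, dist_eq_norm, ← map_sub, ← map_sub, ← map_sub, ← map_sub,
    ← map_sub]
  refine abs_le_of_sq_le_sq' ?_ (by positivity) |>.2
  refine (P.norm_potential_sq_le h w _).trans ?_
  rw [← hC, add_sq, mul_pow, Real.sq_sqrt hC0]
  have : 0 ≤ 2 * ‖P.j (P.hamiltonian h w (s p.1 - s p.2))‖ *
    (Real.sqrt C * ‖P.j (s p.1 - s p.2)‖) := by positivity
  linarith

end CanonicalPair

namespace HarmonicOscillator

variable {n : ℕ}

theorem toTemperedDistribution_conjugate (f : L2 n) (φ : 𝓢(EuclideanSpace ℝ (Fin n), ℂ)) :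
    (f : 𝓢'(EuclideanSpace ℝ (Fin n), ℂ)) (conjugate φ) = inner ℂ (schwartzToL2 φ) f := by
  rw [Lp.toTemperedDistribution_apply]
  refine integral_congr_ae ?_
  filter_upwards [schwartzToL2_ae φ] with x hx
  rw [hx, RCLike.inner_apply, conjugate_apply, smul_eq_mul, mul_comm]

theorem conjugate_conjugate (φ : 𝓢(EuclideanSpace ℝ (Fin n), ℂ)) :
    conjugate (conjugate φ) = φ := by
  ext x
  simp [conjugate_apply]

/-- At order 2 the Bessel symbol is the polynomial 1 + ‖ξ‖², and the multiplier ‖ξ‖² is -(2π)⁻²Δ; so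
Δu ∈ L² already gives u ∈ H². -/
theorem memSobolev_two_of_laplacian {u g : L2 n}
    (hg : Δ (u : 𝓢'(EuclideanSpace ℝ (Fin n), ℂ)) = g) :
    MemSobolev 2 2 (u : 𝓢'(EuclideanSpace ℝ (Fin n), ℂ)) := by
  refine ⟨u - (((2 * Real.pi) ^ 2 : ℝ) : ℂ)⁻¹ • g, ?_⟩
  have h1 : (fun x : EuclideanSpace ℝ (Fin n) =>
      (((1 + ‖x‖ ^ 2) ^ ((2 : ℝ) / 2) : ℝ) : ℂ)) =
      (fun _ => (1 : ℂ)) + fun x => Complex.ofReal (‖x‖ ^ 2) := by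
    ext x
    simp
  have h2 : besselPotential (EuclideanSpace ℝ (Fin n)) ℂ 2 u =
      (u : 𝓢'(EuclideanSpace ℝ (Fin n), ℂ)) +
        fourierMultiplierCLM ℂ (fun x => Complex.ofReal (‖x‖ ^ 2))
          (u : 𝓢'(EuclideanSpace ℝ (Fin n), ℂ)) := by
    rw [besselPotential, h1, fourierMultiplierCLM_apply, smulLeftCLM_add (by fun_prop)
      (by fun_prop), _root_.add_apply, FourierTransform.fourierInv_add,
      ← fourierMultiplierCLM_apply, ← fourierMultiplierCLM_apply, fourierMultiplierCLM_const]
    simp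
  have h3 := laplacian_eq_fourierMultiplierCLM (u : 𝓢'(EuclideanSpace ℝ (Fin n), ℂ))
  rw [hg] at h3
  have h4 : fourierMultiplierCLM ℂ (fun x => Complex.ofReal (‖x‖ ^ 2))
      (u : 𝓢'(EuclideanSpace ℝ (Fin n), ℂ)) = -((((2 * Real.pi) ^ 2 : ℝ) : ℂ)⁻¹ • g) := by
    rw [h3, ← Complex.coe_smul (-(2 * Real.pi) ^ 2), smul_smul, ← neg_smul]
    have h0 : ((2 * Real.pi) ^ 2 : ℝ) ≠ 0 := by positivity
    rw [← Complex.ofReal_inv, ← Complex.ofReal_mul, ← Complex.ofReal_neg]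
    have h5 : -(((2 * Real.pi) ^ 2)⁻¹ * -(2 * Real.pi) ^ 2) = 1 := by
      field_simp
    rw [h5, Complex.ofReal_one, one_smul]
  rw [h2, h4, ← sub_eq_add_neg, sub_eq_add_neg, sub_eq_add_neg, coe_add, ← neg_smul, ← neg_smul,
    coe_smul]

variable (b : OrthonormalBasis (Fin n) ℝ (EuclideanSpace ℝ (Fin n))) {h : ℝ} {w : Fin n → ℝ}

theorem potential_apply (u : 𝓢(EuclideanSpace ℝ (Fin n), ℂ)) (x : EuclideanSpace ℝ (Fin n)) :
    (canonicalPair b).potential w u x =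
      (diagonalForm b (fun i => w i ^ 2) x : ℂ) * u x := by
  have h1 : (canonicalPair b).potential w u =
      ∑ i, ((w i ^ 2 : ℝ) : ℂ) • position (b i) (position (b i) u) := by
    rw [CanonicalPair.potential, LinearMap.sum_apply]
    rfl
  rw [h1, sum_apply, diagonalForm, Complex.ofReal_sum, Finset.sum_mul]
  refine Finset.sum_congr rfl fun i _ => ?_
  change ((w i ^ 2 : ℝ) : ℂ) * position (b i) (position (b i) u) x = _
  rw [position_apply, position_apply]
  push_cast
  ring

theorem kinetic_eq (u : 𝓢(EuclideanSpace ℝ (Fin n), ℂ)) :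
    (canonicalPair b).kinetic h u = -(((h ^ 2 : ℝ) : ℂ) • Δ u) := by
  rw [SchwartzMap.laplacian_eq_sum b, CanonicalPair.kinetic, LinearMap.neg_apply,
    LinearMap.sum_apply, Finset.smul_sum]
  rfl

theorem conjugate_laplacian (u : 𝓢(EuclideanSpace ℝ (Fin n), ℂ)) :
    conjugate (Δ u) = Δ (conjugate u) := by
  let b := stdOrthonormalBasis ℝ (EuclideanSpace ℝ (Fin n))
  have h1 : ∀ v : 𝓢(EuclideanSpace ℝ (Fin n), ℂ),
      Δ v = ∑ i, directional (b i) (directional (b i) v) := SchwartzMap.laplacian_eq_sum b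
  rw [h1, h1, conjugate, map_sum]
  refine Finset.sum_congr rfl fun i _ => ?_
  change conjugate _ = _
  rw [conjugate_directional, conjugate_directional]

theorem schwartzToL2_potential_ae (u : 𝓢(EuclideanSpace ℝ (Fin n), ℂ)) :
    schwartzToL2 ((canonicalPair b).potential w u) =ᵐ[volume]
      fun x => (diagonalForm b (fun i => w i ^ 2) x : ℂ) * schwartzToL2 u x := by
  filter_upwards [schwartzToL2_ae ((canonicalPair b).potential w u), schwartzToL2_ae u]
    with x h1 h2
  rw [h1, h2, potential_apply]

/-- The operator is contained in the adjoint of its restriction to the Schwartz functions. -/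
theorem inner_eq_of_mem_graph {u f : L2 n}
    (huf : (u, f) ∈ (schrodinger (h ^ 2) (diagonalForm b fun i => w i ^ 2)).graph)
    (φ : 𝓢(EuclideanSpace ℝ (Fin n), ℂ)) :
    inner ℂ ((canonicalPair b).j φ) f =
      inner ℂ ((canonicalPair b).j ((canonicalPair b).hamiltonian h w φ)) u := by
  obtain ⟨-, g, hg, hf⟩ := (mem_graph_schrodinger _ _ _ _).1 huf
  have h1 := congrArg (fun T : 𝓢'(EuclideanSpace ℝ (Fin n), ℂ) => T (conjugate φ)) hf
  change Lp.toTemperedDistribution f (conjugate φ) =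
    -(((h ^ 2 : ℝ) : ℂ) • (Δ (u : 𝓢'(EuclideanSpace ℝ (Fin n), ℂ))) (conjugate φ)) +
      Lp.toTemperedDistribution g (conjugate φ) at h1
  rw [laplacian_apply_apply, ← conjugate_laplacian, toTemperedDistribution_conjugate,
    toTemperedDistribution_conjugate, toTemperedDistribution_conjugate] at h1
  have h2 : inner ℂ (schwartzToL2 φ) g =
      inner ℂ (schwartzToL2 ((canonicalPair b).potential w φ)) u := by
    refine integral_congr_ae ?_
    filter_upwards [hg, schwartzToL2_potential_ae b (w := w) φ] with x hx hx'
    rw [hx, hx', RCLike.inner_apply, RCLike.inner_apply, map_mul, Complex.conj_ofReal]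
    ring
  change inner ℂ (schwartzToL2 φ) f = inner ℂ (schwartzToL2 _) u
  rw [h1, h2, CanonicalPair.hamiltonian, LinearMap.add_apply, map_add, inner_add_left, kinetic_eq,
    map_neg, map_smul, inner_neg_left, inner_smul_left, Complex.conj_ofReal, smul_eq_mul]

/-- Multiplication operators are closed: along a common subsequence both L² limits hold almost
everywhere, where the relation is pointwise. -/
theorem eq_mul_of_tendsto {V : EuclideanSpace ℝ (Fin n) → ℂ} {p q : ℕ → L2 n} {u g : L2 n}
    (hp : Tendsto p atTop (𝓝 u)) (hq : Tendsto q atTop (𝓝 g))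
    (hpq : ∀ k, q k =ᵐ[volume] fun x => V x * p k x) : g =ᵐ[volume] fun x => V x * u x := by
  obtain ⟨s, hs, hs'⟩ := (tendstoInMeasure_of_tendsto_Lp hp).exists_seq_tendsto_ae
  obtain ⟨t, ht, ht'⟩ := (tendstoInMeasure_of_tendsto_Lp
    (hq.comp hs.tendsto_atTop)).exists_seq_tendsto_ae
  filter_upwards [hs', ht', ae_all_iff.2 hpq] with x h1 h2 h3
  refine tendsto_nhds_unique h2 ?_
  simp only [Function.comp_apply, h3]
  exact (h1.comp ht.tendsto_atTop).const_mul (V x)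

/-- The operator contains the closure of its restriction to the Schwartz functions. -/
theorem mem_graph_of_tendsto (hh : 0 < h) {s : ℕ → 𝓢(EuclideanSpace ℝ (Fin n), ℂ)} {u f : L2 n}
    (hu : Tendsto (fun k => (canonicalPair b).j (s k)) atTop (𝓝 u))
    (hf : Tendsto (fun k => (canonicalPair b).j ((canonicalPair b).hamiltonian h w (s k))) atTop
      (𝓝 f)) :
    (u, f) ∈ (schrodinger (h ^ 2) (diagonalForm b fun i => w i ^ 2)).graph := by
  obtain ⟨g, hg⟩ := (canonicalPair b).exists_tendsto_potential h w hu hf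
  -- Once the potential part converges, so does the kinetic part; its limit is then -h²Δu as a
  -- distribution, which puts `u` in H².
  have hk : Tendsto (fun k => (canonicalPair b).j ((canonicalPair b).kinetic h (s k))) atTop
      (𝓝 (f - g)) := by
    refine (hf.sub hg).congr fun k => ?_
    rw [← map_sub, CanonicalPair.hamiltonian, LinearMap.add_apply, add_sub_cancel_right]
  have hweak : ∀ φ, inner ℂ (schwartzToL2 φ) (f - g) =
      inner ℂ (schwartzToL2 ((canonicalPair b).kinetic h φ)) u := fun φ =>
    tendsto_nhds_unique (tendsto_const_nhds.inner hk) <| by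
      have h1 := (tendsto_const_nhds (x := schwartzToL2 ((canonicalPair b).kinetic h φ))).inner
        (𝕜 := ℂ) hu
      exact h1.congr fun k => (canonicalPair b).inner_kinetic_left h φ (s k)
  have hdist : ((f - g : L2 n) : 𝓢'(EuclideanSpace ℝ (Fin n), ℂ)) =
      -(((h ^ 2 : ℝ) : ℂ) • Δ (u : 𝓢'(EuclideanSpace ℝ (Fin n), ℂ))) := by
    ext φ
    rw [← conjugate_conjugate φ, toTemperedDistribution_conjugate, hweak]
    change _ = -(((h ^ 2 : ℝ) : ℂ) •
      (Δ (u : 𝓢'(EuclideanSpace ℝ (Fin n), ℂ))) (conjugate (conjugate φ)))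
    rw [laplacian_apply_apply, ← conjugate_laplacian, toTemperedDistribution_conjugate,
      kinetic_eq, map_neg, map_smul, inner_neg_left, inner_smul_left, Complex.conj_ofReal,
      smul_eq_mul]
  have hlap : Δ (u : 𝓢'(EuclideanSpace ℝ (Fin n), ℂ)) =
      ((-(((h ^ 2 : ℝ) : ℂ)⁻¹) • (f - g) : L2 n) : 𝓢'(EuclideanSpace ℝ (Fin n), ℂ)) := by
    have h0 : ((h ^ 2 : ℝ) : ℂ) ≠ 0 := Complex.ofReal_ne_zero.2 (by positivity)
    rw [coe_smul, hdist, smul_neg, neg_smul, neg_neg, smul_smul, inv_mul_cancel₀ h0, one_smul]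
  refine (mem_graph_schrodinger _ _ _ _).2 ⟨memSobolev_two_of_laplacian hlap, g,
    eq_mul_of_tendsto hu hg fun k => schwartzToL2_potential_ae b _, ?_⟩
  rw [← hdist, ← coe_add, sub_add_cancel]

/-- The spectral decomposition of the harmonic oscillator, and its essential self-adjointness on the
Schwartz functions. -/
theorem schrodinger_isDiagonal (hh : 0 < h) (hw : ∀ i, 0 < w i) :
    (∃ β : HilbertBasis (Fin n → ℕ) ℂ (L2 n),
      (schrodinger (h ^ 2) (diagonalForm b fun i => w i ^ 2)).IsDiagonal β
        fun m => ∑ i, (2 * (m i : ℝ) + 1) * h * w i) ∧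
    ∀ u f, (u, f) ∈ (schrodinger (h ^ 2) (diagonalForm b fun i => w i ^ 2)).graph ↔
      ∀ φ, inner ℂ (schwartzToL2 φ) f =
        inner ℂ (schwartzToL2 ((canonicalPair b).hamiltonian h w φ)) u := by
  obtain ⟨β, v, hβ, hv⟩ := exists_hilbertBasis b hh hw
  have := (canonicalPair b).isDiagonal_of_core hβ hv
    (fun u f huf φ => inner_eq_of_mem_graph b huf φ)
    (fun s u f hu hf => mem_graph_of_tendsto b hh hu hf)
  exact ⟨⟨β, this.1⟩, this.2⟩

end HarmonicOscillator

end

/-! ### Diagonalization of the quadratic form and scaling under dilations. -/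

section

open MeasureTheory
open scoped SchwartzMap FourierTransform Laplacian LineDeriv

/-- Equal multisets of values mean fibres of equal size, and bijections between the fibres glue to a
permutation. -/
theorem Fintype.exists_perm_of_map_univ_eq {ι α : Type*} [Fintype ι] [DecidableEq α] {f g : ι → α}
    (h : Multiset.map f Finset.univ.val = Multiset.map g Finset.univ.val) :
    ∃ σ : Equiv.Perm ι, ∀ i, g (σ i) = f i := by
  have hcard : ∀ c, Fintype.card {i // f i = c} = Fintype.card {i // g i = c} := fun c => by
    have h1 := congrArg (Multiset.count c) h
    rw [Multiset.count_map, Multiset.count_map] at h1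
    rw [Fintype.card_subtype, Fintype.card_subtype]
    simpa only [Finset.card_def, Finset.filter_val, eq_comm (a := c)] using h1
  let σ : Equiv.Perm ι := ((Equiv.sigmaFiberEquiv f).symm.trans
    (Equiv.sigmaCongrRight fun c => Fintype.equivOfCardEq (hcard c))).trans (Equiv.sigmaFiberEquiv g)
  exact ⟨σ, fun i => (Fintype.equivOfCardEq (hcard (f i)) ⟨i, rfl⟩).2⟩

namespace LinearPMap

variable {H : Type*} [NormedAddCommGroup H] [InnerProductSpace ℂ H]

theorem mem_graph_unitaryConj (U : H ≃ₗᵢ[ℂ] H) (T : H →ₗ.[ℂ] H) (v g : H) :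
    (v, g) ∈ (unitaryConj U T).graph ↔ (U.symm v, U.symm g) ∈ T.graph := by
  rw [mem_graph_iff, mem_graph_iff]
  constructor
  · rintro ⟨⟨y, hy⟩, rfl, rfl⟩
    exact ⟨⟨U.symm y, hy⟩, rfl, by rw [unitaryConj_apply, U.symm_apply_apply]⟩
  · rintro ⟨⟨y, hy⟩, h1, h2⟩
    dsimp only at h1 h2
    subst h1
    refine ⟨⟨v, hy⟩, rfl, ?_⟩
    rw [unitaryConj_apply, ← U.symm.injective.eq_iff, U.symm_apply_apply]
    exact h2

theorem mem_graph_smul_iff (T : H →ₗ.[ℂ] H) {c : ℂ} (hc : c ≠ 0) (v g : H) :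
    (v, c • g) ∈ (c • T).graph ↔ (v, g) ∈ T.graph := by
  rw [smul_graph, Submodule.mem_map]
  constructor
  · rintro ⟨⟨v', g'⟩, h1, h2⟩
    obtain ⟨h3, h4⟩ := Prod.ext_iff.1 h2
    have h3' : v' = v := h3
    have h4' : c • g' = c • g := h4
    rwa [← h3', ← smul_right_injective H hc h4']
  · exact fun h => ⟨(v, g), h, rfl⟩

end LinearPMap

namespace HarmonicOscillator

variable {n : ℕ}

/-- The roots of the characteristic polynomial identify `w` with the eigenvalues up to order, and
reindexing the eigenvector basis corrects the order. Here `w` lists the eigenvalues themselves,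
later the squares wᵢ². -/
theorem exists_quadForm_eq_diagonalForm {A : Matrix (Fin n) (Fin n) ℝ} (hA : A.IsHermitian)
    {w : Fin n → ℝ} (hAw : A.charpoly = ∏ i, (Polynomial.X - Polynomial.C (w i))) :
    ∃ b : OrthonormalBasis (Fin n) ℝ (EuclideanSpace ℝ (Fin n)),
      quadForm A = diagonalForm b w := by
  have hroots : Multiset.map w Finset.univ.val = Multiset.map hA.eigenvalues Finset.univ.val := by
    have h1 := congrArg Polynomial.roots hAw
    have h2 : ∏ i, (Polynomial.X - Polynomial.C (w i)) =
        ((Finset.univ.val.map w).map fun a => Polynomial.X - Polynomial.C a).prod := by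
      rw [Multiset.map_map]
      rfl
    rw [hA.roots_charpoly_eq_eigenvalues, h2, Polynomial.roots_multiset_prod_X_sub_C] at h1
    exact h1.symm
  obtain ⟨σ, hσ⟩ := Fintype.exists_perm_of_map_univ_eq hroots
  refine ⟨hA.eigenvectorBasis.reindex σ.symm, funext fun x => ?_⟩
  have hsymm := Matrix.isSymmetric_toEuclideanLin_iff.2 hA
  have heig : ∀ k, Matrix.toEuclideanLin A (hA.eigenvectorBasis k) =
      hA.eigenvalues k • hA.eigenvectorBasis k := fun k => by
    rw [Matrix.toLpLin_apply, hA.mulVec_eigenvectorBasis]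
    rfl
  have h1 : quadForm A x = inner ℝ x (Matrix.toEuclideanLin A x) := by
    simp only [quadForm, PiLp.inner_apply, Matrix.toLpLin_apply, Matrix.mulVec, dotProduct,
      RCLike.inner_apply, conj_trivial, Finset.sum_mul]
    exact Finset.sum_congr rfl fun i _ => Finset.sum_congr rfl fun k _ => by ring
  rw [h1, ← (hA.eigenvectorBasis.reindex σ.symm).sum_inner_mul_inner, diagonalForm]
  refine Finset.sum_congr rfl fun i _ => ?_
  rw [OrthonormalBasis.reindex_apply, Equiv.symm_symm, ← hsymm, heig, inner_smul_left, hσ,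
    conj_trivial, real_inner_comm x]
  ring

/-- The dilation of Schwartz functions. -/
def schwartzDilation (θ : ℝ) (hθ : 0 < θ) :
    𝓢(EuclideanSpace ℝ (Fin n), ℂ) →ₗ[ℂ] 𝓢(EuclideanSpace ℝ (Fin n), ℂ) :=
  ((θ ^ ((n : ℝ) / 2) : ℝ) : ℂ) • (SchwartzMap.compCLMOfContinuousLinearEquiv ℂ
    (ContinuousLinearEquiv.smulLeft (Units.mk0 θ hθ.ne'))).toLinearMap

theorem schwartzDilation_apply (θ : ℝ) (hθ : 0 < θ) (u : 𝓢(EuclideanSpace ℝ (Fin n), ℂ))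
    (x : EuclideanSpace ℝ (Fin n)) :
    schwartzDilation θ hθ u x = ((θ ^ ((n : ℝ) / 2) : ℝ) : ℂ) * u (θ • x) := rfl

theorem dilation_schwartzToL2 (θ : ℝ) (hθ : 0 < θ) (u : 𝓢(EuclideanSpace ℝ (Fin n), ℂ)) :
    dilation θ hθ (schwartzToL2 u) = schwartzToL2 (schwartzDilation θ hθ u) := by
  apply Lp.ext
  filter_upwards [dilation_ae θ hθ (schwartzToL2 u), schwartzToL2_ae (schwartzDilation θ hθ u),
    ae_comp_smul hθ (schwartzToL2_ae u)] with x h1 h2 h3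
  rw [h1, h2, h3, schwartzDilation_apply]

theorem schwartzDilation_surjective (θ : ℝ) (hθ : 0 < θ) :
    Function.Surjective (schwartzDilation (n := n) θ hθ) := fun u => by
  refine ⟨schwartzDilation θ⁻¹ (inv_pos.2 hθ) u, ?_⟩
  ext x
  rw [schwartzDilation_apply, schwartzDilation_apply, smul_smul, inv_mul_cancel₀ hθ.ne', one_smul,
    ← mul_assoc, ← Complex.ofReal_mul, ← Real.mul_rpow hθ.le (inv_pos.2 hθ).le,
    mul_inv_cancel₀ hθ.ne', Real.one_rpow, Complex.ofReal_one, one_mul]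

theorem directional_schwartzDilation (θ : ℝ) (hθ : 0 < θ) (v : EuclideanSpace ℝ (Fin n))
    (u : 𝓢(EuclideanSpace ℝ (Fin n), ℂ)) : directional v (schwartzDilation θ hθ u) =
      (θ : ℂ) • schwartzDilation θ hθ (directional v u) := by
  have h1 := SchwartzMap.lineDerivOp_compCLMOfContinuousLinearEquiv ℂ v
    (ContinuousLinearEquiv.smulLeft (R₁ := ℝ) (M₁ := EuclideanSpace ℝ (Fin n))
      (Units.mk0 θ hθ.ne')) u
  have h2 : (∂_{ContinuousLinearEquiv.smulLeft (R₁ := ℝ) (M₁ := EuclideanSpace ℝ (Fin n))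
      (Units.mk0 θ hθ.ne') v} u : 𝓢(EuclideanSpace ℝ (Fin n), ℂ)) =
        (θ : ℂ) • directional v u := by
    change (∂_{θ • v} u : 𝓢(EuclideanSpace ℝ (Fin n), ℂ)) = _
    rw [LineDeriv.lineDerivOp_left_smul]
    rfl
  rw [schwartzDilation, LinearMap.smul_apply, LinearMap.smul_apply, map_smul, smul_comm (θ : ℂ)]
  congr 1
  refine h1.trans ?_
  rw [h2, map_smul]
  rfl

theorem diagonalForm_smul (b : OrthonormalBasis (Fin n) ℝ (EuclideanSpace ℝ (Fin n)))
    (w : Fin n → ℝ) (θ : ℝ) (x : EuclideanSpace ℝ (Fin n)) :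
    diagonalForm b w (θ • x) = θ ^ 2 * diagonalForm b w x := by
  rw [diagonalForm, diagonalForm, Finset.mul_sum]
  refine Finset.sum_congr rfl fun i _ => ?_
  rw [inner_smul_right]
  ring

/-- Dilation by θ turns -Δ into θ⁻²(-Δ) = λ(-Δ) and λ²V into λ²θ²V = λV, so λθ² = 1 scales both
parts by the same factor. -/
theorem schwartzDilation_hamiltonian
    (b : OrthonormalBasis (Fin n) ℝ (EuclideanSpace ℝ (Fin n))) (w : Fin n → ℝ) {lam θ : ℝ}
    (hθ : 0 < θ) (h : lam * θ ^ 2 = 1) (u : 𝓢(EuclideanSpace ℝ (Fin n), ℂ)) :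
    schwartzDilation θ hθ ((canonicalPair b).hamiltonian 1 (fun i => lam * w i) u) =
      (lam : ℂ) • (canonicalPair b).hamiltonian 1 w (schwartzDilation θ hθ u) := by
  have hC : (lam : ℂ) * θ ^ 2 = 1 := by exact_mod_cast h
  rw [CanonicalPair.hamiltonian, CanonicalPair.hamiltonian, LinearMap.add_apply,
    LinearMap.add_apply, map_add, smul_add]
  congr 1
  · have h1 : ∀ v : 𝓢(EuclideanSpace ℝ (Fin n), ℂ), (canonicalPair b).kinetic 1 v =
        -∑ i, directional (b i) (directional (b i) v) := fun v => by
      rw [CanonicalPair.kinetic, LinearMap.neg_apply, LinearMap.sum_apply]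
      simp only [one_pow, Complex.ofReal_one, one_smul]
      rfl
    rw [h1, h1, map_neg, map_sum, smul_neg, Finset.smul_sum]
    refine congrArg Neg.neg (Finset.sum_congr rfl fun i _ => ?_)
    rw [directional_schwartzDilation, map_smul, directional_schwartzDilation, smul_smul, smul_smul]
    have h2 : (lam : ℂ) * θ * θ = 1 := by rw [← hC]; ring
    rw [h2, one_smul]
  · ext x
    change _ = (lam : ℂ) * (canonicalPair b).potential w (schwartzDilation θ hθ u) x
    rw [schwartzDilation_apply, potential_apply, potential_apply, schwartzDilation_apply,
      diagonalForm_smul]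
    have h3 : diagonalForm b (fun i => (lam * w i) ^ 2) x =
        lam ^ 2 * diagonalForm b (fun i => w i ^ 2) x := by
      rw [diagonalForm, diagonalForm, Finset.mul_sum]
      exact Finset.sum_congr rfl fun i _ => by ring
    rw [h3]
    push_cast
    linear_combination ((θ ^ ((n : ℝ) / 2) : ℝ) : ℂ) * u (θ • x) * lam *
      (diagonalForm b (fun i => w i ^ 2) x : ℂ) * hC

theorem dilation_symm_apply {θ θ' : ℝ} (hθ : 0 < θ) (hθ' : 0 < θ') (h : θ * θ' = 1) (f : L2 n) :
    (dilation θ hθ).symm f = dilation θ' hθ' f := by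
  rw [LinearIsometryEquiv.symm_apply_eq]
  exact (dilationFun_dilationFun hθ hθ' h f).symm

/-- Both graphs are described by testing against all Schwartz functions, and the dilation maps these
onto themselves. Thus the scaling identity on test functions suffices, with no separate transport of
H² or of the distributional Laplacian. -/
theorem mem_graph_dilation_symm_iff
    (b : OrthonormalBasis (Fin n) ℝ (EuclideanSpace ℝ (Fin n))) {w : Fin n → ℝ}
    (hw : ∀ i, 0 < w i) {lam θ : ℝ} (hlam : 0 < lam) (hθ : 0 < θ) (h : lam * θ ^ 2 = 1)
    (v g : L2 n) :
    ((dilation θ hθ).symm v, (dilation θ hθ).symm ((lam : ℂ) • g)) ∈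
        (schrodinger (1 ^ 2) (diagonalForm b fun i => (lam * w i) ^ 2)).graph ↔
      (v, g) ∈ (schrodinger (1 ^ 2) (diagonalForm b fun i => w i ^ 2)).graph := by
  have hlam0 : (lam : ℂ) ≠ 0 := Complex.ofReal_ne_zero.2 hlam.ne'
  have hadj : ∀ p q : L2 n,
      inner ℂ p ((dilation θ hθ).symm q) = inner ℂ (dilation θ hθ p) q := fun p q => by
    rw [← (dilation θ hθ).inner_map_map, LinearIsometryEquiv.apply_symm_apply]
  rw [(schrodinger_isDiagonal b one_pos fun i => mul_pos hlam (hw i)).2,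
    (schrodinger_isDiagonal b one_pos hw).2]
  refine Iff.trans (forall_congr' fun φ => ?_) (schwartzDilation_surjective θ hθ).forall.symm
  rw [hadj, hadj, dilation_schwartzToL2, dilation_schwartzToL2,
    schwartzDilation_hamiltonian b w hθ h, map_smul, inner_smul_left, inner_smul_right,
    Complex.conj_ofReal, mul_right_inj' hlam0]

end HarmonicOscillator

end

end

/-! ### Assembly of the theorem. -/

open LinearPMap HarmonicOscillator in
theorem mainTheorem5 {n : ℕ} (A : Matrix (Fin n) (Fin n) ℝ) (hA : A.PosDef)
    (w : Fin n → ℝ) (hw : ∀ i, 0 < w i)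
    (hAw : A.charpoly = ∏ i, (Polynomial.X - Polynomial.C (w i ^ 2)))
    (lam : ℝ) (hlam : 0 < lam) :
    -- unitary equivalence of `K(lam)` and `lam K`
    LinearPMap.unitaryConj
        (HarmonicOscillator.dilation (lam ^ (-(1 / 2) : ℝ)) (Real.rpow_pos_of_pos hlam _))
        (HarmonicOscillator.oscillator A lam) = (lam : ℂ) • HarmonicOscillator.oscillatorK A ∧
    -- the spectrum of `K(lam)`
    LinearPMap.opSpectrum (HarmonicOscillator.oscillator A lam) =
      (fun μ : ℂ => (lam : ℂ) * μ) '' LinearPMap.opSpectrum (HarmonicOscillator.oscillatorK A) ∧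
    LinearPMap.opSpectrum (HarmonicOscillator.oscillator A lam) =
      {z : ℂ | ∃ m : Fin n → ℕ, z = ((∑ i, (2 * (m i : ℝ) + 1) * lam * w i : ℝ) : ℂ)} ∧
    LinearPMap.HasPurelyDiscreteSpectrum (HarmonicOscillator.oscillator A lam) ∧
    -- multiplicities
    (∀ μ : ℂ,
      Module.rank ℂ
          (LinearPMap.eigenspace (HarmonicOscillator.oscillator A lam) ((lam : ℂ) * μ)) =
        Module.rank ℂ (LinearPMap.eigenspace (HarmonicOscillator.oscillatorK A) μ)) ∧
    -- eigenfunctions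
    (∀ (μ : ℂ) (Ψ : HarmonicOscillator.L2 n),
      HarmonicOscillator.dilation (lam ^ (1 / 2 : ℝ)) (Real.rpow_pos_of_pos hlam _) Ψ ∈
          LinearPMap.eigenspace (HarmonicOscillator.oscillator A lam) ((lam : ℂ) * μ) ↔
        Ψ ∈ LinearPMap.eigenspace (HarmonicOscillator.oscillatorK A) μ) ∧
    -- the semiclassical oscillator
    (∀ h : ℝ, 0 < h →
      LinearPMap.opSpectrum (HarmonicOscillator.semiclassical A h) =
          (fun μ : ℂ => (h : ℂ) * μ) ''
            LinearPMap.opSpectrum (HarmonicOscillator.oscillatorK A) ∧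
        LinearPMap.HasPurelyDiscreteSpectrum (HarmonicOscillator.semiclassical A h)) := by
  obtain ⟨b, hb⟩ := exists_quadForm_eq_diagonalForm hA.1 hAw
  -- The coefficient is written `1 ^ 2` to match the form h² of `schrodinger_isDiagonal` at h = 1.
  have hK : oscillatorK A = schrodinger (1 ^ 2) (diagonalForm b fun i => w i ^ 2) := by
    rw [oscillatorK, hb, one_pow]
  have hKlam : oscillator A lam =
      schrodinger (1 ^ 2) (diagonalForm b fun i => (lam * w i) ^ 2) := by
    rw [oscillator, hb, one_pow]
    congr 1
    ext x
    rw [diagonalForm, diagonalForm, Finset.mul_sum]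
    exact Finset.sum_congr rfl fun i _ => by ring
  have hP : ∀ h, semiclassical A h = schrodinger (h ^ 2) (diagonalForm b fun i => w i ^ 2) :=
    fun h => by rw [semiclassical, hb]
  have hlamw : ∀ i, 0 < lam * w i := fun i => mul_pos hlam (hw i)
  obtain ⟨β, hβ⟩ := (schrodinger_isDiagonal b one_pos hw).1
  obtain ⟨γ, hγ⟩ := (schrodinger_isDiagonal b one_pos hlamw).1
  rw [← hK] at hβ
  rw [← hKlam] at hγ
  have hθ := Real.rpow_pos_of_pos hlam (-(1 / 2) : ℝ)
  have hθ' := Real.rpow_pos_of_pos hlam (1 / 2 : ℝ)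
  have hθ1 : lam * (lam ^ (-(1 / 2) : ℝ)) ^ 2 = 1 := by
    rw [← Real.rpow_natCast, ← Real.rpow_mul hlam.le]
    norm_num
    rw [Real.rpow_neg_one]
    exact mul_inv_cancel₀ hlam.ne'
  have hθθ' : lam ^ (-(1 / 2) : ℝ) * lam ^ (1 / 2 : ℝ) = 1 := by
    rw [← Real.rpow_add hlam]
    norm_num
  have hgraph := mem_graph_dilation_symm_iff b hw hlam hθ hθ1
  rw [← hK, ← hKlam] at hgraph
  have hlam0 : (lam : ℂ) ≠ 0 := Complex.ofReal_ne_zero.2 hlam.ne'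
  have heig : ∀ (μ : ℂ) (Ψ : L2 n), (dilation (lam ^ (-(1 / 2) : ℝ)) hθ).symm Ψ ∈
      eigenspace (oscillator A lam) ((lam : ℂ) * μ) ↔ Ψ ∈ eigenspace (oscillatorK A) μ :=
    fun μ Ψ => by
      rw [mem_eigenspace_iff, mem_eigenspace_iff, ← hgraph, _root_.map_smul, _root_.map_smul, smul_smul]
  refine ⟨eq_of_eq_graph ?_, ?_, ?_,
    hγ.hasPurelyDiscreteSpectrum (finite_setOf_abs_sum_le one_pos hlamw), fun μ => ?_,
    fun μ Ψ => ?_, fun h hh => ?_⟩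
  · ext ⟨v, g⟩
    -- Equality of graphs includes equality of domains.
    obtain ⟨g, rfl⟩ : ∃ g', (lam : ℂ) • g' = g := ⟨(lam : ℂ)⁻¹ • g, smul_inv_smul₀ hlam0 g⟩
    rw [mem_graph_unitaryConj, mem_graph_smul_iff _ hlam0, hgraph]
  · rw [hγ.opSpectrum_eq (finite_setOf_abs_sum_le one_pos hlamw),
      hβ.opSpectrum_eq (finite_setOf_abs_sum_le one_pos hw), ← Set.range_comp]
    congr 1
    ext m
    rw [Function.comp_apply, ← Complex.ofReal_mul, Finset.mul_sum]
    exact congrArg _ (Finset.sum_congr rfl fun i _ => by ring)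
  · rw [hγ.opSpectrum_eq (finite_setOf_abs_sum_le one_pos hlamw)]
    ext z
    refine exists_congr fun m => ?_
    rw [eq_comm]
    simp only [mul_one, mul_assoc]
  · have hmap : eigenspace (oscillator A lam) ((lam : ℂ) * μ) =
        (eigenspace (oscillatorK A) μ).map
          (dilation (lam ^ (-(1 / 2) : ℝ)) hθ).symm.toLinearEquiv.toLinearMap := by
      ext Φ
      rw [Submodule.mem_map]
      constructor
      · intro hΦ
        refine ⟨dilation _ hθ Φ, (heig μ _).1 ?_, LinearIsometryEquiv.symm_apply_apply _ _⟩
        rwa [LinearIsometryEquiv.symm_apply_apply]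
      · rintro ⟨Ψ, hΨ, rfl⟩
        exact (heig μ Ψ).2 hΨ
    rw [hmap]
    exact (LinearEquiv.submoduleMap _ _).rank_eq.symm
  · rw [← dilation_symm_apply hθ hθ' hθθ']
    exact heig μ Ψ
  -- No dilation is needed for P(h): its energies ∑ (2mᵢ+1)hwᵢ are read off directly and are h times
  -- those of K.
  · obtain ⟨δ, hδ⟩ := (schrodinger_isDiagonal b hh hw).1
    rw [← hP] at hδ
    refine ⟨?_, hδ.hasPurelyDiscreteSpectrum (finite_setOf_abs_sum_le hh hw)⟩
    rw [hδ.opSpectrum_eq (finite_setOf_abs_sum_le hh hw),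
      hβ.opSpectrum_eq (finite_setOf_abs_sum_le one_pos hw), ← Set.range_comp]
    congr 1
    ext m
    rw [Function.comp_apply, ← Complex.ofReal_mul, Finset.mul_sum]
    exact congrArg _ (Finset.sum_congr rfl fun i _ => by ring)
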